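/- Let $\mathbb U$ be the unit circle, $\mathbb D$ the open unit disk and $\mathbb C_\infty$ the Riemann sphere. For real $t$ put $f_t(z)=z\,e^{\frac t2\frac{1+z}{1-z}}$. For a probability measure $\mu$ on $\mathbb U$ put $\psi_\mu(z)=\int_{\mathbb U}\frac{\omega z}{1-\omega z}\,\mu(d\omega)$ and $\chi_\mu=\psi_\mu/(1+\psi_\mu)$. For $s>0$ let $\nu_s$ be the probability measure on $\mathbb U$ such that $f_s$ is the local inverse of $\chi_{\nu_s}$ at $0$, that is, with $\Sigma$-transform $e^{\frac s2\frac{1+z}{1-z}}$ (it exists and is unique), and let $\chi_s$ be the continuous extension of $\chi_{\nu_s}$ from $\mathbb D$ to $\overline{\mathbb D}$ (which exists). For $s,t>0$ put $\chi_{s,t}=f_{s-t}\circ\chi_s$ on $\overline{\mathbb D}$; it continues analytically to $\mathbb C_\infty\setminus\operatorname{supp}\nu_s$ through $\chi_{s,t}(1/z)=1/\chi_{s,t}(z)$. Put $$\Sigma_{s,t}=\mathbb C_\infty\setminus\overline{\chi_{s,t}(\mathbb C_\infty\setminus\operatorname{supp}\nu_s)}.$$ Theorem. Let $s,t>0$.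 (1) For each $\zeta\in\mathbb U$ there is a unique probability measure $k_{s,t}(\zeta,d\omega)$ on $\mathbb U$ such that, for all $z\in\mathbb D$, $$\int_{\mathbb U}\frac{z\omega}{1-z\omega}\,k_{s,t}(\zeta,d\omega)=\frac{\chi_{s,t}(z)\zeta}{1-\chi_{s,t}(z)\zeta}.$$ If $s=t$, it is the measure $k_s(\zeta,d\omega)$, i.e. the unique probability measure satisfying this identity with $\chi_s$ in place of $\chi_{s,t}$. (2) If $s\ge t/2$ and $\zeta\in\Sigma_{s,t}\cap\mathbb U$, then $k_{s,t}(\zeta,d\omega)$ is absolutely continuous with respect to $\nu_s$, with density $$\frac{|1-\chi_s(\omega)|^2}{(\zeta-\chi_{s,t}(\omega))(\zeta^{-1}-\overline{\chi_{s,t}(\omega)})}\cdot\frac{1-|\chi_{s,t}(\omega)|^2}{1-|\chi_s(\omega)|^2}.$$ (3) If $s\ge t/2$ and $\zeta\in\Sigma_{s,t}\cap\mathbb U$, then $\nu_s$ and $k_{s,t}(\zeta,d\omega)$ are absolutely continuous with respect to each other, with bounded densities (equivalently, the density in (2) is $\nu_s$-almost everywhere bounded above and bounded away from $0$); in particular,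 they have the same support. -/

import Mathlib

open MeasureTheory Filter Topology Set
open scoped ENNReal NNReal

namespace FreeUnitary

noncomputable section

/-- The unit circle with its Borel `σ`-algebra. -/
instance : MeasurableSpace Circle := borel Circle

instance : BorelSpace Circle := ⟨rfl⟩

instance : Nonempty (ProbabilityMeasure Circle) := ⟨⟨Measure.dirac 1, inferInstance⟩⟩

/-- `ψ_μ(z) = ∫ ωz / (1 - ωz) μ(dω)`, for a probability measure `μ` on the unit circle. -/
def psi (μ : ProbabilityMeasure Circle) (z : ℂ) : ℂ :=
  ∫ ω : Circle, ((ω : ℂ) * z) / (1 - (ω : ℂ) * z) ∂(μ : Measure Circle)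

/-- `χ_μ = ψ_μ / (1 + ψ_μ)`. -/
def eta (μ : ProbabilityMeasure Circle) (z : ℂ) : ℂ :=
  psi μ z / (1 + psi μ z)

/-- `μ` has the `Σ`-transform `S`: near `0`, `S` is analytic and the local inverse of `χ_μ` is
`z ↦ z S(z)`. -/
def HasSigmaTransform (μ : ProbabilityMeasure Circle) (S : ℂ → ℂ) : Prop :=
  AnalyticAt ℂ S 0 ∧ ∀ᶠ z in 𝓝 (0 : ℂ), eta μ (z * S z) = z

/-- The function `exp((t/2) (1 + z)/(1 - z))`, for real `t`. -/
def sigmaT (t : ℝ) (z : ℂ) : ℂ :=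
  Complex.exp ((t : ℂ) / 2 * ((1 + z) / (1 - z)))

/-- `f_t(z) = z exp((t/2) (1 + z)/(1 - z))`, for real `t`. -/
def f (t : ℝ) (z : ℂ) : ℂ := z * sigmaT t z

/-- `ν_s`, `s > 0`: the probability measure on the circle with `Σ`-transform
`exp((s/2) (1 + z)/(1 - z))` (the law of free unitary Brownian motion at time `s`). -/
def nu (s : ℝ) : ProbabilityMeasure Circle :=
  Classical.epsilon fun μ => HasSigmaTransform μ (sigmaT s)

open Classical in
/-- `χ_s` on the closed unit disk: the transform `χ_{ν_s}` in the open disk, and its limit from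
inside the disk at a boundary point. -/
def chi (s : ℝ) (z : ℂ) : ℂ :=
  if ‖z‖ < 1 then eta (nu s) z else limUnder (𝓝[Metric.ball 0 1] z) (eta (nu s))

/-- `χ_{s,t} = f_{s-t} ∘ χ_s` on the closed unit disk. -/
def chiST (s t : ℝ) (z : ℂ) : ℂ := f (s - t) (chi s z)

open Classical in
/-- The analytic continuation of `χ_{s,t}` to the complement of `supp ν_s` in the Riemann sphere:
on the open disk it is `χ_{s,t}`, on the part of the unit circle outside `supp ν_s` it is the
boundary value of `χ_{s,t}`, and outside the closed disk it is given by inversion,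
`z ↦ 1 / χ_{s,t}(1/z)`, with `∞ ↦ ∞`. -/
def chiSphere (s t : ℝ) (p : OnePoint ℂ) : OnePoint ℂ :=
  p.elim OnePoint.infty fun z =>
    if ‖z‖ ≤ 1 then ((chiST s t z : ℂ) : OnePoint ℂ)
    else (((chiST s t z⁻¹)⁻¹ : ℂ) : OnePoint ℂ)

/-- `supp ν_s` as a subset of the Riemann sphere. -/
def suppNu (s : ℝ) : Set (OnePoint ℂ) :=
  (fun ω : Circle => ((ω : ℂ) : OnePoint ℂ)) '' (nu s : Measure Circle).support

/-- `Σ_{s,t} = ℂ_∞ ∖ closure (χ_{s,t}(ℂ_∞ ∖ supp ν_s))`. -/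
def SigmaST (s t : ℝ) : Set (OnePoint ℂ) :=
  (closure (chiSphere s t '' (suppNu s)ᶜ))ᶜ

/-- `∫ zω / (1 - zω) κ(dω) = F(z)ζ / (1 - F(z)ζ)` for all `z` in the open unit disk. -/
def HasMomentGenFun (F : ℂ → ℂ) (ζ : Circle) (κ : ProbabilityMeasure Circle) : Prop :=
  ∀ z : ℂ, ‖z‖ < 1 →
    ∫ ω : Circle, (z * (ω : ℂ)) / (1 - z * (ω : ℂ)) ∂(κ : Measure Circle)
      = F z * (ζ : ℂ) / (1 - F z * (ζ : ℂ))

/-- The product `(ζ - χ_{s,t}(ω)) (ζ⁻¹ - conj χ_{s,t}(ω))`. -/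
def denomST (s t : ℝ) (ζ ω : Circle) : ℂ :=
  ((ζ : ℂ) - chiST s t ω) * ((ζ : ℂ)⁻¹ - (starRingEnd ℂ) (chiST s t ω))

/-- The product in `denomST` is a nonnegative real number, so taking its real part in `densST`
loses nothing. -/
theorem denomST_eq (s t : ℝ) (ζ ω : Circle) :
    denomST s t ζ ω = ((‖(ζ : ℂ) - chiST s t ω‖ ^ 2 : ℝ) : ℂ) := by
  have h : (ζ : ℂ)⁻¹ = (starRingEnd ℂ) (ζ : ℂ) := by
    rw [← Circle.coe_inv, Circle.coe_inv_eq_conj]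
  rw [denomST, h, ← map_sub, Complex.mul_conj, Complex.normSq_eq_norm_sq]

/-- The density
`|1 - χ_s(ω)|² / ((ζ - χ_{s,t}(ω)) (ζ⁻¹ - conj χ_{s,t}(ω)))
  * (1 - |χ_{s,t}(ω)|²) / (1 - |χ_s(ω)|²)`. -/
def densST (s t : ℝ) (ζ ω : Circle) : ℝ :=
  ‖1 - chi s ω‖ ^ 2 / (denomST s t ζ ω).re *
    ((1 - ‖chiST s t ω‖ ^ 2) / (1 - ‖chi s ω‖ ^ 2))

end

end FreeUnitary

namespace FreeUnitary

noncomputable section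

open scoped ComplexConjugate

/-! ### Finite measures on the circle are determined by their moments -/

/-! In the coordinate w = (1 + z)/(1 - z), the function f_s becomes φ(w) = (w - 1)/(w + 1) ·
exp(sw/2) (`phi`). It maps a compact region of the closed right half-plane bijectively onto the
closed unit disk (`injOn_phi`, `closedBall_subset_image_phi`). The inverse H (`invPhi`) is
continuous on the closed disk and holomorphic inside, with Re H ≥ 0 and H(0) = 1. By the Herglotz
representation, H is therefore 1 + 2ψ of a probability measure whose density with respect to arc
length is the continuous function ω ↦ Re H(ω⁻¹). Inverting the Cayley coordinate shows that this
measure has the required Σ-transform, so it is ν_s (`nu_eq`).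

Everything then follows from χ_{s,t}(z) = z exp(-tH(z)/2) (`chiST_eq`). It gives |χ_{s,t}(z)| ≤ |z|,
so (1 + χ_{s,t}ζ)/(1 - χ_{s,t}ζ) has nonnegative real part and is the Herglotz transform of the
kernel (`exists_hasMomentGenFun`). For ζ in Σ_{s,t} the denominator has no zero on the closed disk.
The kernel then has the continuous arc-length density (1 - |χ_{s,t}(ω)|²)/|ζ - χ_{s,t}(ω)|², while
that of ν_s is (1 - |χ_s(ω)|²)/|1 - χ_s(ω)|². Their quotient is the stated density.

On the circle 1 - |χ_{s,t}|² = 1 - exp(-t Re H). The only delicate factor of the quotient is thus (1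
- e^{-tx})/(1 - e^{-sx}) with x = Re H, which stays between positive constants for bounded x > 0.

The substantial analytic step is the injectivity of φ up to the boundary. It rests on the estimate
`norm_exp_neg_sub_sq_lt` for differences of exponentials. -/

theorem continuous_circle_coe : Continuous fun ω : Circle => (ω : ℂ) := continuous_induced_dom

theorem integrable_of_continuous_circle {E : Type*} [NormedAddCommGroup E] [SecondCountableTopology E]
    (κ : Measure Circle) [IsFiniteMeasure κ] {g : Circle → E} (hg : Continuous g) :
    Integrable g κ := by
  rw [← integrableOn_univ]
  exact hg.continuousOn.integrableOn_compact isCompact_univ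

/-- The inclusion of the circle in the plane, as a bounded continuous function. -/
def circleCoe : BoundedContinuousFunction Circle ℂ :=
  BoundedContinuousFunction.mkOfCompact ⟨fun ω => (ω : ℂ), continuous_circle_coe⟩

/-- The star algebra generated by the coordinate function separates points, and since star is
inversion on the circle it is spanned by the integer powers. -/
theorem measure_ext_of_zpow {κ κ' : Measure Circle} [IsFiniteMeasure κ] [IsFiniteMeasure κ']
    (h : ∀ n : ℤ, ∫ ω : Circle, (ω : ℂ) ^ n ∂κ = ∫ ω : Circle, (ω : ℂ) ^ n ∂κ') : κ = κ' := by
  refine ext_of_forall_mem_subalgebra_integral_eq_of_polish (𝕜 := ℂ)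
    (A := StarAlgebra.adjoin ℂ {circleCoe}) ?_ ?_
  · intro x y hxy
    refine ⟨fun ω : Circle => (ω : ℂ), ?_, fun h => hxy (Circle.ext h)⟩
    exact ⟨BoundedContinuousFunction.toContinuousMapStarₐ ℂ circleCoe,
      ⟨circleCoe, StarAlgebra.self_mem_adjoin_singleton ℂ _, rfl⟩, rfl⟩
  · intro g hg
    rw [← StarSubalgebra.mem_toSubalgebra, StarAlgebra.adjoin_toSubalgebra,
      ← Subalgebra.mem_toSubmodule, Algebra.adjoin_eq_span] at hg
    induction hg using Submodule.span_induction with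
    | mem g hg =>
      have : ∃ n : ℤ, ∀ ω : Circle, g ω = (ω : ℂ) ^ n := by
        induction hg using Submonoid.closure_induction with
        | mem g hg =>
          rcases hg with hg | hg
          · exact ⟨1, fun ω => by rw [mem_singleton_iff.1 hg, zpow_one]; rfl⟩
          · refine ⟨-1, fun ω => ?_⟩
            have : star g = circleCoe := hg
            rw [← star_star g, this, zpow_neg_one, ← Circle.coe_inv, Circle.coe_inv_eq_conj]
            rfl
        | one => exact ⟨0, fun ω => by simp⟩
        | mul a b _ _ iha ihb =>
          obtain ⟨n, hn⟩ := iha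
          obtain ⟨m, hm⟩ := ihb
          exact ⟨n + m, fun ω => by
            rw [zpow_add₀ (Circle.coe_ne_zero ω), ← hn, ← hm]; rfl⟩
      obtain ⟨n, hn⟩ := this
      simp_rw [hn]
      exact h n
    | zero => simp
    | add a b _ _ iha ihb =>
      simp only [BoundedContinuousFunction.coe_add, Pi.add_apply]
      rw [integral_add (a.integrable _) (b.integrable _),
        integral_add (a.integrable _) (b.integrable _), iha, ihb]
    | smul c a _ iha =>
      simp only [BoundedContinuousFunction.coe_smul]
      rw [integral_smul, integral_smul, iha]

theorem one_sub_mul_circle_ne_zero {z : ℂ} (hz : ‖z‖ < 1) (ω : Circle) : 1 - z * (ω : ℂ) ≠ 0 := by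
  intro h
  have : ‖z * (ω : ℂ)‖ = 1 := by rw [← sub_eq_zero.1 h, norm_one]
  rw [norm_mul, Circle.norm_coe, mul_one] at this
  exact hz.ne this

theorem continuous_momentKernel {z : ℂ} (hz : ‖z‖ < 1) :
    Continuous fun ω : Circle => (z * (ω : ℂ)) / (1 - z * (ω : ℂ)) :=
  (continuous_const.mul continuous_circle_coe).div
    (continuous_const.sub (continuous_const.mul continuous_circle_coe))
    (one_sub_mul_circle_ne_zero hz)

theorem hasSum_moments (κ : Measure Circle) [IsProbabilityMeasure κ] {z : ℂ} (hz : ‖z‖ < 1) :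
    HasSum (fun n : ℕ => z ^ n • ∫ ω : Circle, (ω : ℂ) ^ n ∂κ)
      (1 + ∫ ω : Circle, (z * (ω : ℂ)) / (1 - z * (ω : ℂ)) ∂κ) := by
  have hint : ∀ n : ℕ, Integrable (fun ω : Circle => (z * (ω : ℂ)) ^ n) κ := fun n =>
    integrable_of_continuous_circle κ ((continuous_const.mul continuous_circle_coe).pow n)
  have key := hasSum_integral_of_summable_integral_norm (μ := κ)
    (F := fun (n : ℕ) (ω : Circle) => (z * (ω : ℂ)) ^ n) hint (by
      simp only [norm_pow, norm_mul, Circle.norm_coe, mul_one, integral_const, probReal_univ,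
        smul_eq_mul, one_mul]
      exact summable_geometric_of_lt_one (norm_nonneg _) hz)
  have e1 : ∀ ω : Circle, ∑' n : ℕ, (z * (ω : ℂ)) ^ n
      = 1 + (z * (ω : ℂ)) / (1 - z * (ω : ℂ)) := fun ω => by
    rw [tsum_geometric_of_norm_lt_one (by rwa [norm_mul, Circle.norm_coe, mul_one])]
    have := one_sub_mul_circle_ne_zero hz ω
    field_simp
    ring
  simp_rw [e1] at key
  rw [integral_add (integrable_const _)
    (integrable_of_continuous_circle κ (continuous_momentKernel hz))] at key
  simpa [mul_pow, integral_const_mul] using key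

/-- A probability measure on the circle is determined by the germ at `0` of its moment generating
function. -/
theorem probabilityMeasure_ext_of_eventuallyEq {κ κ' : ProbabilityMeasure Circle}
    (h : ∀ᶠ z : ℂ in 𝓝 0,
      ∫ ω : Circle, (z * (ω : ℂ)) / (1 - z * (ω : ℂ)) ∂(κ : Measure Circle)
        = ∫ ω : Circle, (z * (ω : ℂ)) / (1 - z * (ω : ℂ)) ∂(κ' : Measure Circle)) : κ = κ' := by
  have hball : ∀ᶠ z : ℂ in 𝓝 0, ‖z‖ < 1 := by
    filter_upwards [Metric.ball_mem_nhds (0 : ℂ) one_pos] with z hz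
    exact mem_ball_zero_iff.1 hz
  have hp : ∀ μ : ProbabilityMeasure Circle, HasFPowerSeriesAt
      (fun z : ℂ => 1 + ∫ ω : Circle, (z * (ω : ℂ)) / (1 - z * (ω : ℂ)) ∂(μ : Measure Circle))
      (FormalMultilinearSeries.ofScalars ℂ
        fun n : ℕ => ∫ ω : Circle, (ω : ℂ) ^ n ∂(μ : Measure Circle)) 0 := fun μ => by
    rw [hasFPowerSeriesAt_iff]
    filter_upwards [hball] with z hz
    simpa [FormalMultilinearSeries.coeff_ofScalars] using hasSum_moments (μ : Measure Circle) hz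
  have heq := ((hp κ).congr (h.mono fun z hz => congrArg (1 + ·) hz)).eq_formalMultilinearSeries (hp κ')
  have hnat : ∀ n : ℕ, ∫ ω : Circle, (ω : ℂ) ^ n ∂(κ : Measure Circle)
      = ∫ ω : Circle, (ω : ℂ) ^ n ∂(κ' : Measure Circle) := fun n => by
    have := congrArg (fun p => FormalMultilinearSeries.coeff p n) heq
    simpa only [FormalMultilinearSeries.coeff_ofScalars] using this
  apply Subtype.ext
  refine measure_ext_of_zpow (κ := (κ : Measure Circle)) (κ' := (κ' : Measure Circle)) fun n => ?_
  obtain ⟨n, rfl | rfl⟩ := n.eq_nat_or_neg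
  -- The power series only sees nonnegative moments; the negative ones are their conjugates.
  · simpa using hnat n
  · have : ∀ ω : Circle, (ω : ℂ) ^ (-(n : ℤ)) = conj ((ω : ℂ) ^ n) := fun ω => by
      rw [zpow_neg, zpow_natCast, map_pow, ← Circle.coe_inv_eq_conj, Circle.coe_inv, inv_pow]
    simp_rw [this, integral_conj]
    rw [hnat n]

/-! ### The Herglotz representation -/

/-- The normalised arc length measure, parametrised by `θ ↦ exp (-iθ)`. -/
def arcMeasure : Measure Circle :=
  ENNReal.ofReal (2 * Real.pi)⁻¹ •
    (volume.restrict (Ioc 0 (2 * Real.pi))).map fun θ : ℝ => Circle.exp (-θ)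

theorem measurable_circleExp_neg : Measurable fun θ : ℝ => Circle.exp (-θ) :=
  (Circle.exp.continuous.comp continuous_neg).measurable

instance : IsFiniteMeasure arcMeasure := by
  exact Measure.smul_finite _ ENNReal.ofReal_ne_top

theorem coe_circleExp_neg (θ : ℝ) : ((Circle.exp (-θ) : Circle) : ℂ) = (circleMap 0 1 θ)⁻¹ := by
  rw [circleMap_zero, Circle.coe_exp, Complex.ofReal_one, one_mul,
    ← Complex.exp_neg]
  push_cast
  ring_nf

theorem coe_inv_circleExp_neg (θ : ℝ) : ((Circle.exp (-θ))⁻¹ : ℂ) = circleMap 0 1 θ := by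
  rw [coe_circleExp_neg, inv_inv]

/-- The inversion is built in because zω/(1 - zω) = z/(ω⁻¹ - z) is a Cauchy kernel in ξ = ω⁻¹. -/
theorem integral_arcMeasure {E : Type*} [NormedAddCommGroup E] [NormedSpace ℝ E]
    [SecondCountableTopology E] {g : Circle → E} (hg : Continuous g)
    {F : ℂ → E} (hF : ∀ ω : Circle, g ω = F (ω : ℂ)⁻¹) :
    ∫ ω, g ω ∂arcMeasure = Real.circleAverage F 0 1 := by
  have hpi : (0 : ℝ) ≤ 2 * Real.pi := by positivity
  rw [arcMeasure, integral_smul_measure, integral_map measurable_circleExp_neg.aemeasurable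
    hg.aestronglyMeasurable, Real.circleAverage_def, intervalIntegral.integral_of_le hpi,
    ENNReal.toReal_ofReal (by positivity)]
  simp_rw [hF, coe_inv_circleExp_neg]

/-- The measure with density `ω ↦ Re G(ω⁻¹)` with respect to normalised arc length. -/
def boundaryMeasure (G : ℂ → ℂ) : Measure Circle :=
  arcMeasure.withDensity fun ω => ENNReal.ofReal (G (ω : ℂ)⁻¹).re

theorem circle_inv_mem_sphere (ω : Circle) : (ω : ℂ)⁻¹ ∈ Metric.sphere (0 : ℂ) 1 := by
  rw [mem_sphere_zero_iff_norm, norm_inv, Circle.norm_coe, inv_one]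

theorem continuous_comp_circle_inv {G : ℂ → ℂ} (hG : ContinuousOn G (Metric.closedBall 0 1)) :
    Continuous fun ω : Circle => G (ω : ℂ)⁻¹ :=
  hG.comp_continuous (by fun_prop (disch := exact Circle.coe_ne_zero))
    fun ω => Metric.sphere_subset_closedBall (circle_inv_mem_sphere ω)

/-- The Cauchy integral of the real part of a function holomorphic in the disk. -/
theorem circleAverage_re_mul {G : ℂ → ℂ} (hG : DiffContOnCl ℂ G (Metric.ball 0 1))
    (hG0 : G 0 = 1) {z : ℂ} (hz : ‖z‖ < 1) :
    Real.circleAverage (fun ξ => ((G ξ).re : ℂ) * (z / (ξ - z))) 0 1 = (G z - 1) / 2 := by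
  have hc : ContinuousOn G (Metric.sphere 0 1) :=
    hG.continuousOn_ball.mono Metric.sphere_subset_closedBall
  have hz' : ‖conj z‖ < 1 := by rwa [Complex.norm_conj]
  have hne : ∀ ξ ∈ Metric.closedBall (0 : ℂ) 1, 1 - conj z * ξ ≠ 0 := fun ξ hξ h => by
    have h1 : ‖conj z * ξ‖ = 1 := by rw [← sub_eq_zero.1 h, norm_one]
    rw [norm_mul] at h1
    nlinarith [mem_closedBall_zero_iff.1 hξ, norm_nonneg ξ, norm_nonneg (conj z)]
  have hne' : ∀ ξ ∈ Metric.sphere (0 : ℂ) 1, ξ - z ≠ 0 := fun ξ hξ h => by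
    rw [mem_sphere_zero_iff_norm, sub_eq_zero.1 h] at hξ
    exact hz.ne hξ
  -- On the unit circle this function is the conjugate of z/(ξ - z). Being holomorphic and zero at
  -- 0, its product with G has mean 0, which removes the conj G half of Re G.
  have hk : DiffContOnCl ℂ (fun ξ : ℂ => conj z * ξ / (1 - conj z * ξ)) (Metric.ball 0 1) := by
    refine DifferentiableOn.diffContOnCl ?_
    rw [closure_ball _ one_ne_zero]
    exact DifferentiableOn.div (by fun_prop) (by fun_prop) hne
  have hkG := hk.smul hG
  have a1 : Real.circleAverage (fun ξ => ((ξ - 0) / (ξ - z)) • G ξ) 0 1 = G z :=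
    DiffContOnCl.circleAverage_smul_div (by simpa using hG) (by simpa using hz)
  have a2 : Real.circleAverage G 0 1 = 1 := by
    rw [DiffContOnCl.circleAverage (by simpa using hG), hG0]
  have a3 : Real.circleAverage (fun ξ => (conj z * ξ / (1 - conj z * ξ)) • G ξ) 0 1 = 0 := by
    rw [DiffContOnCl.circleAverage (by simpa using hkG)]
    simp
  have i1 : CircleIntegrable (fun ξ => ((ξ - 0) / (ξ - z)) • G ξ) 0 1 :=
    ContinuousOn.circleIntegrable zero_le_one
      ((ContinuousOn.div (by fun_prop) (by fun_prop) hne').smul hc)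
  have i2 : CircleIntegrable G 0 1 := hc.circleIntegrable zero_le_one
  have i3 : CircleIntegrable (fun ξ => (conj z * ξ / (1 - conj z * ξ)) • G ξ) 0 1 :=
    ContinuousOn.circleIntegrable zero_le_one
      (hkG.continuousOn_ball.mono Metric.sphere_subset_closedBall)
  have i4 : CircleIntegrable (fun ξ => conj ((conj z * ξ / (1 - conj z * ξ)) • G ξ)) 0 1 :=
    ContinuousOn.circleIntegrable zero_le_one (Complex.continuous_conj.comp_continuousOn
      (hkG.continuousOn_ball.mono Metric.sphere_subset_closedBall))
  have a4 : Real.circleAverage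
      (fun ξ => conj ((conj z * ξ / (1 - conj z * ξ)) • G ξ)) 0 1 = 0 := by
    have := (Complex.conjCLE : ℂ →L[ℝ] ℂ).circleAverage_comp_comm i3
    rw [a3, map_zero] at this
    simpa [Function.comp_def] using this
  -- Here Re G = (G + conj G)/2, and z/(ξ - z) = ξ/(ξ - z) - 1 on the part containing G.
  have e : Real.circleAverage (fun ξ => ((G ξ).re : ℂ) * (z / (ξ - z))) 0 1
      = Real.circleAverage (fun ξ => (1 / 2 : ℂ) • ((((ξ - 0) / (ξ - z)) • G ξ - G ξ)
        + conj ((conj z * ξ / (1 - conj z * ξ)) • G ξ))) 0 1 := by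
    refine Real.circleAverage_congr_sphere fun ξ hξ => ?_
    rw [abs_one] at hξ
    have h1 := hne' ξ hξ
    have hξ1 : conj ξ * ξ = 1 := by
      rw [mul_comm, Complex.mul_conj, Complex.normSq_eq_norm_sq, mem_sphere_zero_iff_norm.1 hξ]
      simp
    have hξ0 : ξ ≠ 0 := right_ne_zero_of_mul_eq_one hξ1
    have h2 : conj ξ = ξ⁻¹ := eq_inv_of_mul_eq_one_left hξ1
    have h3 : (1 : ℂ) - z * ξ⁻¹ ≠ 0 := by
      intro h
      apply h1
      have : ξ * (1 - z * ξ⁻¹) = ξ - z := by field_simp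
      rw [← this, h, mul_zero]
    simp only [smul_eq_mul, map_mul, map_div₀, map_sub, map_one, Complex.conj_conj, h2, sub_zero]
    have h4 : z * ξ⁻¹ / (1 - z * ξ⁻¹) = z / (ξ - z) := by
      rw [div_eq_div_iff h3 h1]
      field_simp
    rw [h4, Complex.re_eq_add_conj]
    field_simp
    ring
  have i12 : CircleIntegrable (fun ξ => ((ξ - 0) / (ξ - z)) • G ξ - G ξ) 0 1 := i1.sub i2
  rw [e, Real.circleAverage_fun_smul, Real.circleAverage_fun_add i12 i4,
    Real.circleAverage_fun_sub i1 i2, a1, a2, a4, smul_eq_mul]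
  ring

theorem boundaryMeasure_integral {G : ℂ → ℂ} (hG : ContinuousOn G (Metric.closedBall 0 1))
    (hpos : ∀ ω : Circle, 0 ≤ (G (ω : ℂ)⁻¹).re) (g : Circle → ℂ) :
    ∫ ω, g ω ∂boundaryMeasure G = ∫ ω : Circle, ((G (ω : ℂ)⁻¹).re : ℂ) * g ω ∂arcMeasure := by
  rw [boundaryMeasure, integral_withDensity_eq_integral_toReal_smul]
  · refine integral_congr_ae (Eventually.of_forall fun ω => ?_)
    simp [ENNReal.toReal_ofReal (hpos ω)]
  · exact ((Complex.continuous_re.comp (continuous_comp_circle_inv hG)).measurable).ennreal_ofReal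
  · simp

theorem isProbabilityMeasure_boundaryMeasure {G : ℂ → ℂ}
    (hG : DiffContOnCl ℂ G (Metric.ball 0 1))
    (hpos : ∀ ω : Circle, 0 ≤ (G (ω : ℂ)⁻¹).re) (hG0 : G 0 = 1) :
    IsProbabilityMeasure (boundaryMeasure G) := by
  have hc := hG.continuousOn_ball
  have hre : Continuous fun ω : Circle => (G (ω : ℂ)⁻¹).re :=
    Complex.continuous_re.comp (continuous_comp_circle_inv hc)
  constructor
  rw [boundaryMeasure, withDensity_apply _ MeasurableSet.univ, Measure.restrict_univ,
    ← ofReal_integral_eq_lintegral_ofReal (integrable_of_continuous_circle _ hre)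
      (Eventually.of_forall hpos),
    integral_arcMeasure (F := fun ξ => (G ξ).re) hre fun ω => rfl]
  have h1 : Real.circleAverage G 0 1 = 1 := by
    rw [DiffContOnCl.circleAverage (by simpa using hG), hG0]
  have h2 := Complex.reCLM.circleAverage_comp_comm (f := G) (c := 0) (R := 1)
    ((hc.mono Metric.sphere_subset_closedBall).circleIntegrable zero_le_one)
  rw [h1] at h2
  have h3 : Real.circleAverage (fun ξ => (G ξ).re) 0 1 = 1 := by simpa [Function.comp_def] using h2
  rw [h3, ENNReal.ofReal_one]

theorem boundaryMeasure_momentGenFun {G : ℂ → ℂ} (hG : DiffContOnCl ℂ G (Metric.ball 0 1))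
    (hpos : ∀ ω : Circle, 0 ≤ (G (ω : ℂ)⁻¹).re) (hG0 : G 0 = 1) {z : ℂ} (hz : ‖z‖ < 1) :
    ∫ ω : Circle, (z * (ω : ℂ)) / (1 - z * (ω : ℂ)) ∂boundaryMeasure G = (G z - 1) / 2 := by
  have hc := hG.continuousOn_ball
  rw [boundaryMeasure_integral hc hpos, ← circleAverage_re_mul hG hG0 hz]
  refine integral_arcMeasure ?_ fun ω => ?_
  · exact (Complex.continuous_ofReal.comp
      (Complex.continuous_re.comp (continuous_comp_circle_inv hc))).mul (continuous_momentKernel hz)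
  · have h1 := one_sub_mul_circle_ne_zero hz ω
    have h2 := Circle.coe_ne_zero ω
    congr 1
    field_simp

/-- **Herglotz representation**: a holomorphic function in the disk with nonnegative real part and
value `1` at `0` is the Herglotz integral of a probability measure on the circle. -/
theorem exists_probabilityMeasure_momentGenFun {G : ℂ → ℂ}
    (hG : DifferentiableOn ℂ G (Metric.ball 0 1))
    (hpos : ∀ z ∈ Metric.ball (0 : ℂ) 1, 0 ≤ (G z).re) (hG0 : G 0 = 1) :
    ∃ κ : ProbabilityMeasure Circle, ∀ z : ℂ, ‖z‖ < 1 →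
      ∫ ω : Circle, (z * (ω : ℂ)) / (1 - z * (ω : ℂ)) ∂(κ : Measure Circle) = (G z - 1) / 2 := by
  set r : ℕ → ℝ := fun n => 1 - 1 / ((n : ℝ) + 1) with hr
  have hr0 : ∀ n, 0 ≤ r n := fun n => by
    have : 1 / ((n : ℝ) + 1) ≤ 1 := by
      rw [div_le_one (by positivity)]
      linarith [n.cast_nonneg (α := ℝ)]
    simp only [hr]
    linarith
  have hr1 : ∀ n, r n < 1 := fun n => by
    have : 0 < 1 / ((n : ℝ) + 1) := by positivity
    simp only [hr]
    linarith
  have hrlim : Tendsto r atTop (𝓝 1) := by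
    simpa [hr] using (tendsto_const_nhds (x := (1 : ℝ))).sub
      (tendsto_one_div_add_atTop_nhds_zero_nat (𝕜 := ℝ))
  have hmem : ∀ n, ∀ z ∈ Metric.closedBall (0 : ℂ) 1, (r n : ℂ) * z ∈ Metric.ball (0 : ℂ) 1 := by
    intro n z hz
    rw [mem_ball_zero_iff, norm_mul, Complex.norm_of_nonneg (hr0 n)]
    nlinarith [mem_closedBall_zero_iff.1 hz, norm_nonneg z, hr0 n, hr1 n]
  have hd : ∀ n, DiffContOnCl ℂ (fun z => G ((r n : ℂ) * z)) (Metric.ball 0 1) := fun n => by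
    refine DifferentiableOn.diffContOnCl ?_
    rw [closure_ball _ one_ne_zero]
    exact hG.comp (by fun_prop) (hmem n)
  have hp : ∀ n, ∀ ω : Circle, 0 ≤ (G ((r n : ℂ) * (ω : ℂ)⁻¹)).re := fun n ω =>
    hpos _ (hmem n _ (Metric.sphere_subset_closedBall (circle_inv_mem_sphere ω)))
  have h0 : ∀ n, G ((r n : ℂ) * 0) = 1 := fun n => by rw [mul_zero, hG0]
  let κ : ℕ → ProbabilityMeasure Circle := fun n =>
    ⟨boundaryMeasure fun z => G ((r n : ℂ) * z),
      isProbabilityMeasure_boundaryMeasure (hd n) (hp n) (h0 n)⟩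
  -- The dilates G(r_n z) are continuous on the closed disk, so they have boundary measures. Weak
  -- compactness of the probability measures on the circle gives a limit along an ultrafilter.
  let U : Ultrafilter (ProbabilityMeasure Circle) := (hyperfilter ℕ).map κ
  have hU : Tendsto κ (hyperfilter ℕ) (𝓝 U.lim) := U.le_nhds_lim
  refine ⟨U.lim, fun z hz => ?_⟩
  have t1 := (ProbabilityMeasure.tendsto_iff_forall_integral_rclike_tendsto ℂ).1 hU
    (BoundedContinuousFunction.mkOfCompact ⟨_, continuous_momentKernel hz⟩)
  have t2 : Tendsto (fun n => (G ((r n : ℂ) * z) - 1) / 2) (hyperfilter ℕ)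
      (𝓝 ((G z - 1) / 2)) := by
    have hGz : ContinuousAt G z :=
      (hG.differentiableAt (Metric.isOpen_ball.mem_nhds (mem_ball_zero_iff.2 hz))).continuousAt
    have : Tendsto (fun n => (r n : ℂ) * z) (hyperfilter ℕ) (𝓝 z) := by
      have h := ((Complex.continuous_ofReal.tendsto 1).comp hrlim).mul_const z
      simp only [Complex.ofReal_one, one_mul] at h
      exact h.mono_left Nat.hyperfilter_le_atTop
    exact ((hGz.tendsto.comp this).sub_const 1).div_const 2
  refine tendsto_nhds_unique t1 (t2.congr fun n => ?_)
  exact (boundaryMeasure_momentGenFun (hd n) (hp n) (h0 n) hz).symm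

/-! ### The function `sinh x / x` -/

/-- `sinh x / x`, with the value `1` at `0`. -/
def sinhc : ℝ → ℝ := dslope Real.sinh 0

theorem sinhc_zero : sinhc 0 = 1 := by
  rw [sinhc, dslope_same, Real.deriv_sinh, Real.cosh_zero]

theorem mul_sinhc (x : ℝ) : x * sinhc x = Real.sinh x := by
  simpa [sinhc] using sub_smul_dslope Real.sinh 0 x

theorem continuous_sinhc : Continuous sinhc := by
  rw [← continuousOn_univ]
  exact (continuousOn_dslope univ_mem).2
    ⟨Real.continuous_sinh.continuousOn, Real.differentiable_sinh 0⟩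

theorem one_le_sinhc {x : ℝ} (hx : 0 ≤ x) : 1 ≤ sinhc x := by
  rcases hx.eq_or_lt with rfl | hx
  · rw [sinhc_zero]
  · have := Real.self_le_sinh_iff.2 hx.le
    rw [← mul_sinhc] at this
    exact le_of_mul_le_mul_left (by rwa [mul_one]) hx

theorem sinh_lt_mul_cosh {x : ℝ} (hx : 0 < x) : Real.sinh x < x * Real.cosh x := by
  have hmono : StrictMonoOn (fun y => y * Real.cosh y - Real.sinh y) (Ici 0) := by
    refine strictMonoOn_of_deriv_pos (convex_Ici 0) (by fun_prop) fun y hy => ?_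
    rw [interior_Ici] at hy
    have hd : HasDerivAt (fun y => y * Real.cosh y - Real.sinh y)
        (1 * Real.cosh y + y * Real.sinh y - Real.cosh y) y :=
      ((hasDerivAt_id' y).mul (Real.hasDerivAt_cosh y)).sub (Real.hasDerivAt_sinh y)
    rw [hd.deriv]
    have := mul_pos hy (Real.sinh_pos_iff.2 hy)
    linarith
  have := hmono self_mem_Ici hx.le hx
  simp only [zero_mul, Real.sinh_zero, sub_zero] at this
  linarith

theorem sinhc_le_sinhc {x y : ℝ} (hx : 0 < x) (hxy : x ≤ y) : sinhc x ≤ sinhc y := by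
  have hmono : MonotoneOn (fun y => x * Real.sinh y - y * Real.sinh x) (Ici x) := by
    refine monotoneOn_of_deriv_nonneg (convex_Ici x) (by fun_prop) (by fun_prop) fun y hy => ?_
    rw [interior_Ici] at hy
    have hd : HasDerivAt (fun y => x * Real.sinh y - y * Real.sinh x)
        (x * Real.cosh y - 1 * Real.sinh x) y :=
      ((Real.hasDerivAt_sinh y).const_mul x).sub ((hasDerivAt_id' y).mul_const _)
    rw [hd.deriv]
    have h1 := sinh_lt_mul_cosh hx
    have h2 : Real.cosh x ≤ Real.cosh y := by
      rw [Real.cosh_le_cosh, abs_of_pos hx, abs_of_pos (hx.trans hy)]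
      exact (le_of_lt hy)
    nlinarith
  have := hmono self_mem_Ici hxy hxy
  simp only [sub_self, ← mul_sinhc] at this
  have hpos : 0 < x * y := mul_pos hx (hx.trans_le hxy)
  exact le_of_mul_le_mul_left (by nlinarith) hpos

/-- With d = 2e this reads 4 sinh² e < 4e sinh e cosh e. -/
theorem two_mul_cosh_sub_one_lt {d : ℝ} (hd : 0 < d) :
    2 * (Real.cosh d - 1) < d ^ 2 * sinhc d := by
  obtain ⟨e, rfl⟩ : ∃ e, d = 2 * e := ⟨d / 2, by ring⟩
  have he : 0 < e := by linarith
  have h1 : (2 * e) ^ 2 * sinhc (2 * e) = 2 * e * Real.sinh (2 * e) := by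
    rw [← mul_sinhc (2 * e)]
    ring
  rw [h1, Real.sinh_two_mul, Real.cosh_two_mul]
  have h2 := sinh_lt_mul_cosh he
  have h3 := Real.sinh_pos_iff.2 he
  nlinarith [Real.cosh_sq e]

theorem two_mul_cosh_sub_sub_one_lt {a b : ℝ} (ha : 0 ≤ a) (hb : 0 ≤ b) (hab : a ≠ b) :
    2 * (Real.cosh (a - b) - 1) < (a - b) ^ 2 * (sinhc a * sinhc b) := by
  wlog h : b < a generalizing a b
  · have := this hb ha hab.symm (lt_of_le_of_ne (not_lt.1 h) hab)
    rwa [← neg_sub a b, Real.cosh_neg, neg_sq, mul_comm (sinhc b)] at this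
  have hd : 0 < a - b := sub_pos.2 h
  refine (two_mul_cosh_sub_one_lt hd).trans_le (mul_le_mul_of_nonneg_left ?_ (sq_nonneg _))
  have h1 := sinhc_le_sinhc hd (sub_le_self a hb)
  have h2 := one_le_sinhc hb
  have h3 := one_le_sinhc ha
  nlinarith

/-- A sharp estimate for the difference of two values of the exponential function. -/
theorem norm_exp_neg_sub_sq_lt {p q : ℂ} (hp : 0 ≤ p.re) (hq : 0 ≤ q.re) (hpq : p ≠ q) :
    ‖Complex.exp (-p) - Complex.exp (-q)‖ ^ 2
      < ‖p - q‖ ^ 2 * (Real.exp (-p.re) * sinhc p.re * (Real.exp (-q.re) * sinhc q.re)) := by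
  -- Separating moduli and arguments leaves a cosh term in the real parts and a cosine term in the
  -- imaginary parts, which are bounded independently.
  have e1 : ‖Complex.exp (-p) - Complex.exp (-q)‖ ^ 2 = Real.exp (-p.re) * Real.exp (-q.re) *
      (2 * (Real.cosh (p.re - q.re) - 1) + 2 * (1 - Real.cos (p.im - q.im))) := by
    have hc : Real.exp (-p.re) * Real.exp (-q.re) * (2 * Real.cosh (p.re - q.re))
        = Real.exp (-p.re) ^ 2 + Real.exp (-q.re) ^ 2 := by
      rw [Real.cosh_eq]
      have h1 : Real.exp (-(p.re - q.re)) = Real.exp (-p.re) * Real.exp q.re := by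
        rw [← Real.exp_add]; ring_nf
      have h2 : Real.exp (p.re - q.re) = Real.exp p.re * Real.exp (-q.re) := by
        rw [← Real.exp_add]; ring_nf
      have h3 : Real.exp p.re * Real.exp (-p.re) = 1 := by rw [← Real.exp_add]; simp
      have h4 : Real.exp q.re * Real.exp (-q.re) = 1 := by rw [← Real.exp_add]; simp
      rw [h1, h2]
      linear_combination (Real.exp (-q.re)) ^ 2 * h3 + (Real.exp (-p.re)) ^ 2 * h4
    rw [← Complex.normSq_eq_norm_sq, Complex.normSq_apply]
    simp only [Complex.sub_re, Complex.sub_im, Complex.exp_re, Complex.exp_im, Complex.neg_re,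
      Complex.neg_im, Real.cos_neg, Real.sin_neg, Real.cos_sub]
    linear_combination -hc + Real.exp (-p.re) ^ 2 * Real.sin_sq_add_cos_sq p.im
      + Real.exp (-q.re) ^ 2 * Real.sin_sq_add_cos_sq q.im
  have e2 : ‖p - q‖ ^ 2 = (p.re - q.re) ^ 2 + (p.im - q.im) ^ 2 := by
    rw [← Complex.normSq_eq_norm_sq, Complex.normSq_apply, Complex.sub_re, Complex.sub_im]
    ring
  rw [e1, e2]
  have hS : 1 ≤ sinhc p.re * sinhc q.re := by nlinarith [one_le_sinhc hp, one_le_sinhc hq]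
  have hre : 2 * (Real.cosh (p.re - q.re) - 1)
      ≤ (p.re - q.re) ^ 2 * (sinhc p.re * sinhc q.re) := by
    rcases eq_or_ne p.re q.re with h | h
    · rw [h]; simp
    · exact (two_mul_cosh_sub_sub_one_lt hp hq h).le
  have him : 2 * (1 - Real.cos (p.im - q.im)) ≤ (p.im - q.im) ^ 2 := by
    have := Real.one_sub_sq_div_two_le_cos (x := p.im - q.im)
    linarith
  have him' : (p.im - q.im) ^ 2 ≤ (p.im - q.im) ^ 2 * (sinhc p.re * sinhc q.re) :=
    le_mul_of_one_le_right (sq_nonneg _) hS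
  have hlt : 2 * (Real.cosh (p.re - q.re) - 1) + 2 * (1 - Real.cos (p.im - q.im))
      < ((p.re - q.re) ^ 2 + (p.im - q.im) ^ 2) * (sinhc p.re * sinhc q.re) := by
    rw [add_mul]
    rcases eq_or_ne p.re q.re with h | h
    · have hi : p.im - q.im ≠ 0 := fun hi => hpq (Complex.ext h (sub_eq_zero.1 hi))
      have := Real.one_sub_sq_div_two_lt_cos hi
      linarith
    · have := two_mul_cosh_sub_sub_one_lt hp hq h
      linarith
  have hE : 0 < Real.exp (-p.re) * Real.exp (-q.re) := by positivity
  calc _ < Real.exp (-p.re) * Real.exp (-q.re) *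
        (((p.re - q.re) ^ 2 + (p.im - q.im) ^ 2) * (sinhc p.re * sinhc q.re)) :=
        mul_lt_mul_of_pos_left hlt hE
    _ = _ := by ring

/-! ### The conformal map in the right half-plane -/

/-- The function `f s` in the coordinate `w = (1 + z) / (1 - z)`. -/
def phi (s : ℝ) (w : ℂ) : ℂ := (w - 1) / (w + 1) * Complex.exp ((s : ℂ) / 2 * w)

/-- The closure of the region in the right half-plane that `phi s` maps conformally onto the unit
disk. -/
def phiRegion (s : ℝ) : Set ℂ :=
  {w | 0 ≤ w.re ∧ s * ‖w + 1‖ ^ 2 * (Real.exp (-(s / 2 * w.re)) * sinhc (s / 2 * w.re)) ≤ 4}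

theorem add_one_ne_zero_of_re_nonneg {w : ℂ} (hw : 0 ≤ w.re) : w + 1 ≠ 0 := by
  intro h
  have := congrArg Complex.re h
  simp at this
  linarith

theorem norm_sub_one_sq (w : ℂ) : ‖w - 1‖ ^ 2 = ‖w + 1‖ ^ 2 - 4 * w.re := by
  rw [← Complex.normSq_eq_norm_sq, ← Complex.normSq_eq_norm_sq, Complex.normSq_apply,
    Complex.normSq_apply]
  simp
  ring

theorem norm_phi (s : ℝ) (w : ℂ) :
    ‖phi s w‖ = ‖w - 1‖ / ‖w + 1‖ * Real.exp (s / 2 * w.re) := by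
  rw [phi, norm_mul, norm_div, Complex.norm_exp]
  congr 2
  have : (s : ℂ) / 2 = ((s / 2 : ℝ) : ℂ) := by push_cast; rfl
  rw [this, Complex.re_ofReal_mul]

/-- With a = s Re(w)/2, the bound on |φ| says |w + 1|²(1 - e^{-2a}) ≤ 4 Re w, and 1 - e^{-2a} = s
Re(w) e^{-a} sinhc a. Cancelling Re w gives the condition in `phiRegion`, which still cuts out a
bounded piece of the imaginary axis, where |φ| = 1 throughout. -/
theorem norm_phi_le_one_iff {s : ℝ} {w : ℂ} (hw : 0 ≤ w.re) : ‖phi s w‖ ≤ 1 ↔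
    w.re * (s * ‖w + 1‖ ^ 2 * (Real.exp (-(s / 2 * w.re)) * sinhc (s / 2 * w.re))) ≤ w.re * 4 := by
  have hw1 : 0 < ‖w + 1‖ := norm_pos_iff.2 (add_one_ne_zero_of_re_nonneg hw)
  set a := s / 2 * w.re with ha
  have h1 : w.re * (s * ‖w + 1‖ ^ 2 * (Real.exp (-a) * sinhc a))
      = ‖w + 1‖ ^ 2 * (1 - Real.exp (-a) ^ 2) := by
    have h2 : 2 * (a * sinhc a) * Real.exp (-a) = 1 - Real.exp (-a) ^ 2 := by
      have h3 : Real.exp a * Real.exp (-a) = 1 := by rw [← Real.exp_add]; simp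
      rw [mul_sinhc, Real.sinh_eq]
      linear_combination h3
    rw [← h2, ha]
    ring
  have hexp : Real.exp a = (Real.exp (-a))⁻¹ := by rw [Real.exp_neg, inv_inv]
  have hE := Real.exp_pos (-a)
  rw [h1, norm_phi, ← ha, hexp, ← div_eq_mul_inv, div_div, div_le_one (by positivity),
    ← pow_le_pow_iff_left₀ (norm_nonneg _) (by positivity) two_ne_zero, norm_sub_one_sq, mul_pow]
  constructor <;> intro h <;> linarith

theorem norm_phi_le_one {s : ℝ} {w : ℂ} (hw : w ∈ phiRegion s) : ‖phi s w‖ ≤ 1 :=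
  (norm_phi_le_one_iff hw.1).2 (mul_le_mul_of_nonneg_left hw.2 hw.1)

theorem mem_phiRegion {s : ℝ} {w : ℂ} (hw : 0 < w.re) (h : ‖phi s w‖ ≤ 1) : w ∈ phiRegion s :=
  ⟨hw.le, le_of_mul_le_mul_left ((norm_phi_le_one_iff hw.le).1 h) hw⟩

theorem re_pos_of_norm_phi_lt_one {s : ℝ} {w : ℂ} (hw : 0 ≤ w.re) (h : ‖phi s w‖ < 1) :
    0 < w.re := by
  rcases hw.eq_or_lt with h0 | h0
  · exfalso
    have h1 := norm_sub_one_sq w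
    rw [← h0, mul_zero, sub_zero, pow_left_inj₀ (norm_nonneg _) (norm_nonneg _) two_ne_zero] at h1
    rw [norm_phi, h1, ← h0, mul_zero, Real.exp_zero, mul_one,
      div_self (norm_ne_zero_iff.2 (add_one_ne_zero_of_re_nonneg hw))] at h
    exact lt_irrefl _ h
  · exact h0

theorem isCompact_phiRegion {s : ℝ} (hs : 0 < s) : IsCompact (phiRegion s) := by
  have hcl : IsClosed (phiRegion s) := by
    have := continuous_sinhc
    have h : Continuous fun w : ℂ =>
        s * ‖w + 1‖ ^ 2 * (Real.exp (-(s / 2 * w.re)) * sinhc (s / 2 * w.re)) := by fun_prop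
    exact (isClosed_le continuous_const Complex.continuous_re).inter
      (isClosed_le h continuous_const)
  refine Metric.isCompact_of_isClosed_isBounded hcl
    ((Metric.isBounded_closedBall (x := (0 : ℂ)) (r := 5 + 4 / s)).subset fun w hw => ?_)
  rw [mem_closedBall_zero_iff]
  obtain ⟨h0, h4⟩ := hw
  set a := s / 2 * w.re with ha
  have ha0 : 0 ≤ a := by positivity
  -- Since e^{-a} sinhc a = (1 - e^{-2a})/(2a) ≥ 1/(1 + 2a), the region satisfies s|w + 1|² ≤ 4(1 +
  -- s Re w): quadratic growth against linear, hence boundedness.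
  have key : 1 ≤ (1 + 2 * a) * (Real.exp (-a) * sinhc a) := by
    rcases ha0.eq_or_lt with h | h
    · rw [← h, sinhc_zero]; simp
    · have h3 : Real.exp a * Real.exp (-a) = 1 := by rw [← Real.exp_add]; simp
      have h5 : 2 * a * (Real.exp (-a) * sinhc a) = 1 - Real.exp (-a) ^ 2 := by
        have := mul_sinhc a
        rw [Real.sinh_eq] at this
        linear_combination (2 * Real.exp (-a)) * this + h3
      have h6 : (1 + 2 * a) * Real.exp (-a) ^ 2 ≤ 1 := by
        have h7 := Real.add_one_le_exp (2 * a)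
        have h8 : Real.exp (2 * a) * Real.exp (-a) ^ 2 = 1 := by
          rw [← Real.exp_nat_mul, ← Real.exp_add]; simp
        nlinarith [sq_nonneg (Real.exp (-a))]
      nlinarith
  have hx : w.re + 1 ≤ ‖w + 1‖ := by simpa using Complex.re_le_norm (w + 1)
  have h9 : s * ‖w + 1‖ ^ 2 ≤ 4 * (1 + 2 * a) := by
    have h10 : s * ‖w + 1‖ ^ 2 * 1 ≤
        s * ‖w + 1‖ ^ 2 * ((1 + 2 * a) * (Real.exp (-a) * sinhc a)) :=
      mul_le_mul_of_nonneg_left key (by positivity)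
    nlinarith
  have h11 : ‖w + 1‖ ^ 2 ≤ 4 / s + 4 * ‖w + 1‖ := by
    have : s * ‖w + 1‖ ^ 2 ≤ s * (4 / s + 4 * ‖w + 1‖) := by
      rw [mul_add, mul_div_cancel₀ _ hs.ne']
      nlinarith
    exact le_of_mul_le_mul_left this hs
  have h12 : ‖w + 1‖ ≤ 4 + 4 / s := by
    by_contra! h
    have : 0 < 4 / s := by positivity
    nlinarith
  have h13 : ‖w‖ ≤ ‖w + 1‖ + 1 := by
    calc ‖w‖ = ‖(w + 1) - 1‖ := by rw [add_sub_cancel_right]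
      _ ≤ ‖w + 1‖ + ‖(1 : ℂ)‖ := norm_sub_le _ _
      _ = _ := by rw [norm_one]
  linarith

/-- If φ takes the same value c at two points, then w₁ - w₂ is c times a difference of exponentials
times (w₁ + 1)(w₂ + 1)/2. With |c| ≤ 1, the strict exponential estimate and the two defining
inequalities of the region yield |w₁ - w₂|² < |w₁ - w₂|². -/
theorem injOn_phi {s : ℝ} (hs : 0 < s) : InjOn (phi s) (phiRegion s) := by
  intro w₁ h₁ w₂ h₂ h
  by_contra hne
  have n₁ := add_one_ne_zero_of_re_nonneg h₁.1
  have n₂ := add_one_ne_zero_of_re_nonneg h₂.1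
  have hre : ∀ w : ℂ, ((s : ℂ) / 2 * w).re = s / 2 * w.re := fun w => by
    rw [show (s : ℂ) / 2 = ((s / 2 : ℝ) : ℂ) by push_cast; rfl, Complex.re_ofReal_mul]
  have hs2 : (s : ℂ) / 2 ≠ 0 := by simpa using hs.ne'
  have key := norm_exp_neg_sub_sq_lt (p := (s : ℂ) / 2 * w₁) (q := (s : ℂ) / 2 * w₂)
    (by rw [hre]; exact mul_nonneg (by positivity) h₁.1)
    (by rw [hre]; exact mul_nonneg (by positivity) h₂.1)
    (fun h => hne (mul_left_cancel₀ hs2 h))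
  rw [hre, hre, ← mul_sub, norm_mul, mul_pow] at key
  set e₁ := Complex.exp (-((s : ℂ) / 2 * w₁)) with he₁
  set e₂ := Complex.exp (-((s : ℂ) / 2 * w₂)) with he₂
  have hu : ∀ w : ℂ, (w - 1) / (w + 1) = phi s w * Complex.exp (-((s : ℂ) / 2 * w)) := fun w => by
    rw [phi, mul_assoc, ← Complex.exp_add, add_neg_cancel, Complex.exp_zero, mul_one]
  have hdiff : w₁ - w₂ = phi s w₁ * (e₁ - e₂) * ((w₁ + 1) * (w₂ + 1)) / 2 := by
    have h3 : phi s w₁ * (e₁ - e₂) = (w₁ - 1) / (w₁ + 1) - (w₂ - 1) / (w₂ + 1) := by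
      rw [hu w₁, hu w₂, ← h, mul_sub]
    rw [h3]
    field_simp
    ring
  have hnorm : ‖w₁ - w₂‖ ^ 2
      ≤ ‖e₁ - e₂‖ ^ 2 * (‖w₁ + 1‖ ^ 2 * ‖w₂ + 1‖ ^ 2) / 4 := by
    have h4 := norm_phi_le_one h₁
    have h5 : ‖phi s w₁‖ ^ 2 ≤ 1 := pow_le_one₀ (norm_nonneg _) h4
    rw [hdiff, norm_div, norm_mul, norm_mul, norm_mul, Complex.norm_ofNat, div_pow, mul_pow,
      mul_pow, mul_pow]
    have h6 : 0 ≤ ‖e₁ - e₂‖ ^ 2 * (‖w₁ + 1‖ ^ 2 * ‖w₂ + 1‖ ^ 2) := by positivity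
    nlinarith
  set A := Real.exp (-(s / 2 * w₁.re)) * sinhc (s / 2 * w₁.re) with hA
  set B := Real.exp (-(s / 2 * w₂.re)) * sinhc (s / 2 * w₂.re) with hB
  have hnn : ∀ w ∈ phiRegion s, 0 ≤ Real.exp (-(s / 2 * w.re)) * sinhc (s / 2 * w.re) :=
    fun w hw => mul_nonneg (Real.exp_pos _).le
      (zero_le_one.trans (one_le_sinhc (mul_nonneg (by positivity) hw.1)))
  have hA0 := hnn _ h₁
  have hB0 := hnn _ h₂
  have hprod : (s * ‖w₁ + 1‖ ^ 2 * A) * (s * ‖w₂ + 1‖ ^ 2 * B) ≤ 4 * 4 :=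
    mul_le_mul h₁.2 h₂.2 (by positivity) (by norm_num)
  have hs2n : ‖(s : ℂ) / 2‖ ^ 2 = s ^ 2 / 4 := by
    rw [norm_div, Complex.norm_of_nonneg hs.le, Complex.norm_ofNat, div_pow]
    norm_num
  rw [hs2n] at key
  have hN : 0 < ‖w₁ + 1‖ ^ 2 * ‖w₂ + 1‖ ^ 2 := by positivity
  have hD : 0 ≤ ‖w₁ - w₂‖ ^ 2 := by positivity
  have k1 := mul_lt_mul_of_pos_right key hN
  have k2 := mul_le_mul_of_nonneg_left hprod hD
  nlinarith

theorem analyticAt_phi (s : ℝ) {w : ℂ} (hw : 0 ≤ w.re) : AnalyticAt ℂ (phi s) w := by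
  have := add_one_ne_zero_of_re_nonneg hw
  unfold phi
  fun_prop (disch := assumption)

theorem continuousOn_phi (s : ℝ) : ContinuousOn (phi s) (phiRegion s) := fun _ hw =>
  (analyticAt_phi s hw.1).continuousAt.continuousWithinAt

/-- The image of Ω is open by the open mapping theorem. It is also relatively closed in the disk:
limit points lie in the image of the compact region, and a preimage with |φ| < 1 cannot lie on the
imaginary axis. Connectedness fills the open disk, and compactness adds its boundary. -/
theorem closedBall_subset_image_phi {s : ℝ} (hs : 0 < s) :
    Metric.closedBall 0 1 ⊆ phi s '' phiRegion s := by
  have hcpt := (isCompact_phiRegion hs).image_of_continuousOn (continuousOn_phi s)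
  set Ω : Set ℂ := {w | 0 < w.re} ∩ phi s ⁻¹' Metric.ball 0 1 with hΩ
  have hH : IsOpen {w : ℂ | 0 < w.re} := isOpen_lt continuous_const Complex.continuous_re
  have hΩo : IsOpen Ω := ContinuousOn.isOpen_inter_preimage
    (fun w hw => (analyticAt_phi s (le_of_lt hw)).continuousAt.continuousWithinAt) hH
    Metric.isOpen_ball
  have hΩK : Ω ⊆ phiRegion s := fun w hw => mem_phiRegion hw.1 (mem_ball_zero_iff.1 hw.2).le
  have h1 : phi s 1 = 0 := by simp [phi]
  have himg : IsOpen (phi s '' Ω) := by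
    rcases AnalyticOnNhd.is_constant_or_isOpen (g := phi s) (U := {w : ℂ | 0 < w.re})
      (fun w hw => analyticAt_phi s (le_of_lt hw))
      (convex_halfSpace_re_gt 0).isPreconnected with ⟨c, hc⟩ | ho
    · exfalso
      have h2 : phi s 2 = phi s 1 := by rw [hc 2 (by simp), hc 1 (by simp)]
      rw [h1, phi] at h2
      norm_num [Complex.exp_ne_zero] at h2
    · exact ho Ω inter_subset_left hΩo
  have hball : Metric.ball (0 : ℂ) 1 ⊆ phi s '' Ω := by
    refine (convex_ball (0 : ℂ) 1).isPreconnected.subset_of_closure_inter_subset himg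
      ⟨0, by simp, 1, ⟨by simp, by simp [h1]⟩, h1⟩ ?_
    rintro z ⟨hz, hzb⟩
    obtain ⟨w, hw, rfl⟩ := closure_minimal (image_mono hΩK) hcpt.isClosed hz
    exact ⟨w, ⟨re_pos_of_norm_phi_lt_one hw.1 (mem_ball_zero_iff.1 hzb), hzb⟩, rfl⟩
  rw [← closure_ball _ one_ne_zero]
  exact closure_minimal (hball.trans (image_mono hΩK)) hcpt.isClosed

/-! ### The inverse conformal map -/

/-- The inverse of `phi s`, from the closed unit disk to the closed right half-plane. It is the
Herglotz transform of `nu s`. -/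
def invPhi (s : ℝ) : ℂ → ℂ := Function.invFunOn (phi s) (phiRegion s)

section InvPhi

variable {s : ℝ}

theorem invPhi_mem (hs : 0 < s) {z : ℂ} (hz : ‖z‖ ≤ 1) : invPhi s z ∈ phiRegion s :=
  Function.invFunOn_mem (closedBall_subset_image_phi hs (mem_closedBall_zero_iff.2 hz))

theorem phi_invPhi (hs : 0 < s) {z : ℂ} (hz : ‖z‖ ≤ 1) : phi s (invPhi s z) = z :=
  Function.invFunOn_eq (closedBall_subset_image_phi hs (mem_closedBall_zero_iff.2 hz))

theorem invPhi_phi (hs : 0 < s) {w : ℂ} (hw : w ∈ phiRegion s) : invPhi s (phi s w) = w :=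
  (injOn_phi hs).leftInvOn_invFunOn hw

theorem re_invPhi_nonneg (hs : 0 < s) {z : ℂ} (hz : ‖z‖ ≤ 1) : 0 ≤ (invPhi s z).re :=
  (invPhi_mem hs hz).1

theorem invPhi_add_one_ne_zero (hs : 0 < s) {z : ℂ} (hz : ‖z‖ ≤ 1) : invPhi s z + 1 ≠ 0 :=
  add_one_ne_zero_of_re_nonneg (re_invPhi_nonneg hs hz)

theorem one_mem_phiRegion : (1 : ℂ) ∈ phiRegion s :=
  mem_phiRegion (by simp) (by simp [phi])

theorem invPhi_zero (hs : 0 < s) : invPhi s 0 = 1 := by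
  have := invPhi_phi hs (one_mem_phiRegion (s := s))
  rwa [phi, sub_self, zero_div, zero_mul] at this

/-- The inverse of a continuous injection on a compact set is continuous. -/
theorem continuousOn_invPhi (hs : 0 < s) : ContinuousOn (invPhi s) (Metric.closedBall 0 1) := by
  rw [continuousOn_iff_isClosed]
  intro t ht
  refine ⟨phi s '' (phiRegion s ∩ t), (((isCompact_phiRegion hs).inter_right ht).image_of_continuousOn
    ((continuousOn_phi s).mono inter_subset_left)).isClosed, ?_⟩
  ext z
  refine ⟨fun ⟨hz, hb⟩ => ⟨⟨invPhi s z, ⟨invPhi_mem hs (mem_closedBall_zero_iff.1 hb), hz⟩,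
    phi_invPhi hs (mem_closedBall_zero_iff.1 hb)⟩, hb⟩, ?_⟩
  rintro ⟨⟨w, ⟨hw, hwt⟩, rfl⟩, hb⟩
  exact ⟨by rwa [mem_preimage, invPhi_phi hs hw], hb⟩

theorem hasDerivAt_phi {w : ℂ} (hw : 0 ≤ w.re) : HasDerivAt (phi s)
    (Complex.exp ((s : ℂ) / 2 * w) * (4 + s * ((w - 1) * (w + 1))) / (2 * (w + 1) ^ 2)) w := by
  have h := add_one_ne_zero_of_re_nonneg hw
  have h1 := (((hasDerivAt_id' w).sub_const 1).div ((hasDerivAt_id' w).add_const 1) h).mul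
    (((hasDerivAt_id' w).const_mul ((s : ℂ) / 2)).cexp)
  refine h1.congr_deriv ?_
  rw [Pi.div_apply]
  field_simp
  ring

/-- A critical point has s|w - 1||w + 1| = 4, while |φ| < 1 gives |w - 1| < |w + 1|e^{-a}. Together
they force 4 < s|w + 1|²e^{-a}, against the definition of the region because sinhc a ≥ 1. -/
theorem deriv_phi_ne_zero (hs : 0 < s) {w : ℂ} (hw : w ∈ phiRegion s) (h : ‖phi s w‖ < 1) :
    Complex.exp ((s : ℂ) / 2 * w) * (4 + s * ((w - 1) * (w + 1))) / (2 * (w + 1) ^ 2) ≠ 0 := by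
  have h1 := add_one_ne_zero_of_re_nonneg hw.1
  refine div_ne_zero (mul_ne_zero (Complex.exp_ne_zero _) fun h0 => ?_)
    (mul_ne_zero two_ne_zero (pow_ne_zero 2 h1))
  have h2 : (s : ℂ) * ((w - 1) * (w + 1)) = -4 := by linear_combination h0
  have h3 : s * (‖w - 1‖ * ‖w + 1‖) = 4 := by
    have := congrArg norm h2
    rwa [norm_mul, norm_mul, norm_neg, Complex.norm_ofNat, Complex.norm_of_nonneg hs.le] at this
  set a := s / 2 * w.re with ha
  have hE : Real.exp a * Real.exp (-a) = 1 := by rw [← Real.exp_add]; simp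
  have hw1 : 0 < ‖w + 1‖ := norm_pos_iff.2 h1
  rw [norm_phi, div_mul_eq_mul_div, div_lt_one hw1, ← ha] at h
  have h4 : ‖w - 1‖ < ‖w + 1‖ * Real.exp (-a) := by
    have := mul_lt_mul_of_pos_right h (Real.exp_pos (-a))
    rwa [mul_assoc, hE, mul_one] at this
  have h5 := hw.2
  rw [← ha] at h5
  have h6 : 1 ≤ sinhc a := one_le_sinhc (mul_nonneg (by positivity) hw.1)
  have h7 : s * ‖w + 1‖ ^ 2 * (Real.exp (-a) * 1) ≤ s * ‖w + 1‖ ^ 2 * (Real.exp (-a) * sinhc a) := by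
    gcongr
  have h8 : s * (‖w - 1‖ * ‖w + 1‖) < s * (‖w + 1‖ * Real.exp (-a) * ‖w + 1‖) := by gcongr
  nlinarith

theorem differentiableOn_invPhi (hs : 0 < s) :
    DifferentiableOn ℂ (invPhi s) (Metric.ball 0 1) := by
  intro z hz
  have hz' := mem_ball_zero_iff.1 hz
  have hn := Metric.isOpen_ball.mem_nhds hz
  refine (HasDerivAt.of_local_left_inverse (f := phi s)
    ((continuousOn_invPhi hs).continuousAt
      (mem_of_superset hn Metric.ball_subset_closedBall))
    (hasDerivAt_phi (re_invPhi_nonneg hs hz'.le))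
    (deriv_phi_ne_zero hs (invPhi_mem hs hz'.le) (by rwa [phi_invPhi hs hz'.le]))
    ?_).differentiableAt.differentiableWithinAt
  filter_upwards [hn] with y hy
  exact phi_invPhi hs (mem_ball_zero_iff.1 hy).le

theorem diffContOnCl_invPhi (hs : 0 < s) : DiffContOnCl ℂ (invPhi s) (Metric.ball 0 1) :=
  ⟨differentiableOn_invPhi hs, by
    rw [closure_ball _ one_ne_zero]
    exact continuousOn_invPhi hs⟩

theorem phi_conj (w : ℂ) : phi s (conj w) = conj (phi s w) := by
  simp only [phi, map_mul, map_div₀, map_sub, map_add, map_one, ← Complex.exp_conj,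
    Complex.conj_ofReal, Complex.conj_ofNat]

theorem conj_mem_phiRegion {w : ℂ} (hw : w ∈ phiRegion s) : conj w ∈ phiRegion s := by
  have : ‖conj w + 1‖ = ‖w + 1‖ := by
    rw [← Complex.norm_conj (w + 1), map_add, map_one]
  simpa only [phiRegion, mem_ofPred_eq, Complex.conj_re, this] using hw

theorem invPhi_conj (hs : 0 < s) {z : ℂ} (hz : ‖z‖ ≤ 1) :
    invPhi s (conj z) = conj (invPhi s z) := by
  rw [← invPhi_phi hs (conj_mem_phiRegion (invPhi_mem hs hz)), phi_conj, phi_invPhi hs hz]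

end InvPhi

/-! ### The law of free unitary Brownian motion -/

theorem psi_eq (μ : ProbabilityMeasure Circle) (z : ℂ) :
    psi μ z = ∫ ω : Circle, (z * (ω : ℂ)) / (1 - z * (ω : ℂ)) ∂(μ : Measure Circle) := by
  simp_rw [psi, mul_comm]

/-- The radius 1/3 bounds the integrand by (1/3)/(2/3) = 1/2. -/
theorem one_add_psi_ne_zero (μ : ProbabilityMeasure Circle) {z : ℂ} (hz : ‖z‖ < 1 / 3) :
    1 + psi μ z ≠ 0 := by
  have hb : ‖psi μ z‖ ≤ 1 / 2 := by
    rw [psi_eq]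
    have := norm_integral_le_of_norm_le_const (μ := (μ : Measure Circle)) (C := 1 / 2)
      (f := fun ω : Circle => (z * (ω : ℂ)) / (1 - z * (ω : ℂ)))
      (Eventually.of_forall fun ω => by
        have h1 : ‖z * (ω : ℂ)‖ = ‖z‖ := by rw [norm_mul, Circle.norm_coe, mul_one]
        have h2 : 1 - ‖z‖ ≤ ‖1 - z * (ω : ℂ)‖ := by
          have := norm_sub_norm_le (1 : ℂ) (z * (ω : ℂ))
          rwa [norm_one, h1] at this
        rw [norm_div, h1, div_le_iff₀ (by linarith)]
        linarith)
    simpa using this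
  intro h
  rw [eq_neg_of_add_eq_zero_right h, norm_neg, norm_one] at hb
  norm_num at hb

theorem phi_cayley (s : ℝ) {z : ℂ} (hz : z ≠ 1) : phi s ((1 + z) / (1 - z)) = f s z := by
  have h : 1 - z ≠ 0 := sub_ne_zero.2 hz.symm
  have h1 : ((1 + z) / (1 - z) - 1) / ((1 + z) / (1 - z) + 1) = z := by
    have h2 : (1 + z) / (1 - z) + 1 = 2 / (1 - z) := by field_simp; ring
    have h3 : (1 + z) / (1 - z) - 1 = 2 * z / (1 - z) := by field_simp; ring
    rw [h2, h3]
    field_simp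
  rw [phi, h1, f, sigmaT]

theorem cayley_cayley {w : ℂ} (hw : w + 1 ≠ 0) :
    (1 + (w - 1) / (w + 1)) / (1 - (w - 1) / (w + 1)) = w := by
  have h1 : 1 + (w - 1) / (w + 1) = 2 * w / (w + 1) := by field_simp; ring
  have h2 : 1 - (w - 1) / (w + 1) = 2 / (w + 1) := by field_simp; ring
  rw [h1, h2]
  field_simp

theorem cayley_ne_one {w : ℂ} (hw : w + 1 ≠ 0) : (w - 1) / (w + 1) ≠ 1 := by
  rw [Ne, div_eq_one_iff_eq hw]
  intro h
  have : (2 : ℂ) = 0 := by linear_combination -h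
  exact two_ne_zero this

theorem f_cayley (s : ℝ) {w : ℂ} (hw : w + 1 ≠ 0) : f s ((w - 1) / (w + 1)) = phi s w := by
  rw [← phi_cayley s (cayley_ne_one hw), cayley_cayley hw]

theorem analyticAt_sigmaT (s : ℝ) : AnalyticAt ℂ (sigmaT s) 0 := by
  unfold sigmaT
  have : (1 : ℂ) - 0 ≠ 0 := by simp
  fun_prop (disch := assumption)

variable {s t : ℝ}

theorem eventually_norm_lt {r : ℝ} (hr : 0 < r) : ∀ᶠ z : ℂ in 𝓝 0, ‖z‖ < r := by
  filter_upwards [Metric.ball_mem_nhds (0 : ℂ) hr] with z hz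
  exact mem_ball_zero_iff.1 hz

/-- The probability measure whose Herglotz transform is `invPhi s`. -/
def brownianLaw (hs : 0 < s) : ProbabilityMeasure Circle :=
  ⟨boundaryMeasure (invPhi s), isProbabilityMeasure_boundaryMeasure (diffContOnCl_invPhi hs)
    (fun ω => re_invPhi_nonneg hs (by simp [Circle.norm_coe])) (invPhi_zero hs)⟩

theorem psi_brownianLaw (hs : 0 < s) {z : ℂ} (hz : ‖z‖ < 1) :
    psi (brownianLaw hs) z = (invPhi s z - 1) / 2 := by
  rw [psi_eq]
  exact boundaryMeasure_momentGenFun (diffContOnCl_invPhi hs)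
    (fun ω => re_invPhi_nonneg hs (by simp [Circle.norm_coe])) (invPhi_zero hs) hz

theorem eta_brownianLaw (hs : 0 < s) {z : ℂ} (hz : ‖z‖ < 1) :
    eta (brownianLaw hs) z = (invPhi s z - 1) / (invPhi s z + 1) := by
  have h := invPhi_add_one_ne_zero hs hz.le
  have h1 : 1 + (invPhi s z - 1) / 2 = (invPhi s z + 1) / 2 := by ring
  rw [eta, psi_brownianLaw hs hz, h1]
  field_simp

theorem hasSigmaTransform_brownianLaw (hs : 0 < s) :
    HasSigmaTransform (brownianLaw hs) (sigmaT s) := by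
  refine ⟨analyticAt_sigmaT s, ?_⟩
  have hc : ContinuousAt (fun z : ℂ => (1 + z) / (1 - z)) 0 := by
    have : (1 : ℂ) - 0 ≠ 0 := by simp
    fun_prop (disch := assumption)
  have hlim : Tendsto (fun z : ℂ => (1 + z) / (1 - z)) (𝓝 0) (𝓝 1) := by
    simpa using hc.tendsto
  have hphi : ∀ᶠ w : ℂ in 𝓝 1, 0 < w.re ∧ ‖phi s w‖ < 1 := by
    refine (Complex.continuous_re.continuousAt.eventually (lt_mem_nhds (by simp))).and ?_
    have h := (analyticAt_phi s (w := 1) (by simp)).continuousAt.norm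
    exact h.eventually (gt_mem_nhds (by simp [phi]))
  filter_upwards [hlim.eventually hphi, eventually_norm_lt one_pos] with z hz hz1
  have hne : z ≠ 1 := fun h => by rw [h, norm_one] at hz1; exact lt_irrefl _ hz1
  have hf : z * sigmaT s z = phi s ((1 + z) / (1 - z)) := (phi_cayley s hne).symm
  have h : (1 : ℂ) - z ≠ 0 := sub_ne_zero.2 hne.symm
  rw [hf, eta_brownianLaw hs hz.2, invPhi_phi hs (mem_phiRegion hz.1 hz.2.le)]
  have h2 : (1 + z) / (1 - z) + 1 = 2 / (1 - z) := by field_simp; ring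
  have h3 : (1 + z) / (1 - z) - 1 = 2 * z / (1 - z) := by field_simp; ring
  rw [h2, h3]
  field_simp

theorem eq_brownianLaw (hs : 0 < s) {μ : ProbabilityMeasure Circle}
    (h : HasSigmaTransform μ (sigmaT s)) : μ = brownianLaw hs := by
  refine probabilityMeasure_ext_of_eventuallyEq ?_
  have hH : ContinuousAt (invPhi s) 0 := (continuousOn_invPhi hs).continuousAt
    (Metric.closedBall_mem_nhds _ one_pos)
  have hc : ContinuousAt (fun y => (invPhi s y - 1) / (invPhi s y + 1)) 0 :=
    (hH.sub continuousAt_const).div (hH.add continuousAt_const)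
      (invPhi_add_one_ne_zero hs (by simp))
  have hlim : Tendsto (fun y => (invPhi s y - 1) / (invPhi s y + 1)) (𝓝 0) (𝓝 0) := by
    simpa [invPhi_zero hs] using hc.tendsto
  -- Evaluating the Σ-transform identity at z = (H(y) - 1)/(H(y) + 1), where z S(z) = φ(H(y)) = y,
  -- determines ψ_μ near 0.
  filter_upwards [hlim.eventually h.2, eventually_norm_lt one_pos,
    eventually_norm_lt (r := 1 / 3) (by norm_num)] with y hy hy1 hy3
  have hne := invPhi_add_one_ne_zero hs hy1.le
  have hf := f_cayley s hne
  rw [phi_invPhi hs hy1.le] at hf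
  rw [f] at hf
  rw [hf, eta] at hy
  rw [← psi_eq, ← psi_eq, psi_brownianLaw hs hy1]
  rw [div_eq_div_iff (one_add_psi_ne_zero μ hy3) hne] at hy
  linear_combination hy / 2

theorem nu_eq (hs : 0 < s) : nu s = brownianLaw hs :=
  eq_brownianLaw hs (Classical.epsilon_spec
    (p := fun μ => HasSigmaTransform μ (sigmaT s)) ⟨_, hasSigmaTransform_brownianLaw hs⟩)

theorem hasSigmaTransform_iff (hs : 0 < s) (μ : ProbabilityMeasure Circle) :
    HasSigmaTransform μ (sigmaT s) ↔ μ = nu s := by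
  rw [nu_eq hs]
  exact ⟨eq_brownianLaw hs, fun h => h ▸ hasSigmaTransform_brownianLaw hs⟩

/-! ### The functions `chi` and `chiST` on the closed disk -/

theorem continuousOn_cayley_invPhi (hs : 0 < s) :
    ContinuousOn (fun z => (invPhi s z - 1) / (invPhi s z + 1)) (Metric.closedBall 0 1) :=
  ((continuousOn_invPhi hs).sub continuousOn_const).div
    ((continuousOn_invPhi hs).add continuousOn_const)
    fun _ hz => invPhi_add_one_ne_zero hs (mem_closedBall_zero_iff.1 hz)

theorem chi_eq (hs : 0 < s) {z : ℂ} (hz : ‖z‖ ≤ 1) :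
    chi s z = (invPhi s z - 1) / (invPhi s z + 1) := by
  rw [chi, nu_eq hs]
  split_ifs with h
  · exact eta_brownianLaw hs h
  · have : (𝓝[Metric.ball 0 1] z).NeBot := by
      rw [← mem_closure_iff_nhdsWithin_neBot, closure_ball _ one_ne_zero]
      exact mem_closedBall_zero_iff.2 hz
    refine Tendsto.limUnder_eq (((continuousOn_cayley_invPhi hs z (mem_closedBall_zero_iff.2 hz)).mono
      Metric.ball_subset_closedBall).tendsto.congr' ?_)
    filter_upwards [self_mem_nhdsWithin] with y hy
    exact (eta_brownianLaw hs (mem_ball_zero_iff.1 hy)).symm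

theorem continuousOn_chi (hs : 0 < s) : ContinuousOn (chi s) (Metric.closedBall 0 1) :=
  (continuousOn_cayley_invPhi hs).congr fun _ hz => chi_eq hs (mem_closedBall_zero_iff.1 hz)

theorem cayley_chi (hs : 0 < s) {z : ℂ} (hz : ‖z‖ ≤ 1) :
    (1 + chi s z) / (1 - chi s z) = invPhi s z := by
  rw [chi_eq hs hz, cayley_cayley (invPhi_add_one_ne_zero hs hz)]

theorem chi_mul_exp (hs : 0 < s) {z : ℂ} (hz : ‖z‖ ≤ 1) :
    chi s z * Complex.exp ((s : ℂ) / 2 * invPhi s z) = z := by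
  rw [chi_eq hs hz]
  exact phi_invPhi hs hz

theorem chi_eq_mul_exp (hs : 0 < s) {z : ℂ} (hz : ‖z‖ ≤ 1) :
    chi s z = z * Complex.exp (-((s : ℂ) / 2 * invPhi s z)) := by
  nth_rewrite 2 [← chi_mul_exp hs hz]
  rw [mul_assoc, ← Complex.exp_add, add_neg_cancel, Complex.exp_zero, mul_one]

/-- The exponents (s - t)/2 from f_{s-t} and -s/2 from χ_s add up, leaving -t/2. -/
theorem chiST_eq (hs : 0 < s) (t : ℝ) {z : ℂ} (hz : ‖z‖ ≤ 1) :
    chiST s t z = z * Complex.exp (-((t : ℂ) / 2 * invPhi s z)) := by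
  rw [chiST, f, sigmaT, cayley_chi hs hz, chi_eq_mul_exp hs hz, mul_assoc, ← Complex.exp_add]
  congr 2
  push_cast
  ring

theorem chiST_self (s : ℝ) (z : ℂ) : chiST s s z = chi s z := by
  simp [chiST, f, sigmaT]

theorem continuousOn_chiST (hs : 0 < s) (t : ℝ) :
    ContinuousOn (chiST s t) (Metric.closedBall 0 1) := by
  have := continuousOn_invPhi hs
  have h : ContinuousOn (fun z => z * Complex.exp (-((t : ℂ) / 2 * invPhi s z)))
      (Metric.closedBall 0 1) := by fun_prop
  exact h.congr fun z hz => chiST_eq hs t (mem_closedBall_zero_iff.1 hz)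

theorem differentiableOn_chiST (hs : 0 < s) (t : ℝ) :
    DifferentiableOn ℂ (chiST s t) (Metric.ball 0 1) := by
  have := differentiableOn_invPhi hs
  have h : DifferentiableOn ℂ (fun z => z * Complex.exp (-((t : ℂ) / 2 * invPhi s z)))
      (Metric.ball 0 1) := by fun_prop
  exact h.congr fun z hz => chiST_eq hs t (mem_ball_zero_iff.1 hz).le

theorem norm_mul_exp_neg (t : ℝ) (z w : ℂ) :
    ‖z * Complex.exp (-((t : ℂ) / 2 * w))‖ = ‖z‖ * Real.exp (-(t / 2 * w.re)) := by
  rw [norm_mul, Complex.norm_exp, Complex.neg_re, show (t : ℂ) / 2 = ((t / 2 : ℝ) : ℂ) by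
    push_cast; rfl, Complex.re_ofReal_mul]

theorem norm_chiST_le (hs : 0 < s) (ht : 0 ≤ t) {z : ℂ} (hz : ‖z‖ ≤ 1) :
    ‖chiST s t z‖ ≤ ‖z‖ := by
  rw [chiST_eq hs t hz, norm_mul_exp_neg]
  refine mul_le_of_le_one_right (norm_nonneg _) (Real.exp_le_one_iff.2 ?_)
  have := mul_nonneg (by positivity : 0 ≤ t / 2) (re_invPhi_nonneg hs hz)
  linarith

theorem chiST_conj (hs : 0 < s) (t : ℝ) {z : ℂ} (hz : ‖z‖ ≤ 1) :
    chiST s t (conj z) = conj (chiST s t z) := by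
  rw [chiST_eq hs t hz, chiST_eq hs t (by rwa [Complex.norm_conj]), invPhi_conj hs hz, map_mul,
    ← Complex.exp_conj]
  simp only [map_neg, map_mul, map_div₀, Complex.conj_ofReal, Complex.conj_ofNat]

theorem norm_chiST_circle_sq (hs : 0 < s) (t : ℝ) (ω : Circle) :
    ‖chiST s t ω‖ ^ 2 = Real.exp (-(t * (invPhi s ω).re)) := by
  rw [chiST_eq hs t (Circle.norm_coe ω).le, norm_mul_exp_neg, Circle.norm_coe, one_mul,
    ← Real.exp_nat_mul]
  congr 1
  push_cast
  ring

theorem re_cayley (u : ℂ) :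
    ((1 + u) / (1 - u)).re = (1 - ‖u‖ ^ 2) / ‖1 - u‖ ^ 2 := by
  rw [Complex.div_re, ← Complex.normSq_eq_norm_sq, ← Complex.normSq_eq_norm_sq, ← add_div,
    Complex.normSq_apply u]
  congr 1
  simp
  ring

theorem one_sub_chi (hs : 0 < s) {z : ℂ} (hz : ‖z‖ ≤ 1) :
    1 - chi s z = 2 / (invPhi s z + 1) := by
  have := invPhi_add_one_ne_zero hs hz
  rw [chi_eq hs hz]
  field_simp
  ring

/-! ### The kernel -/

/-- The function whose Herglotz measure is the kernel at `ζ`. -/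
def kernelFun (s t : ℝ) (ζ : Circle) (z : ℂ) : ℂ :=
  (1 + chiST s t z * (ζ : ℂ)) / (1 - chiST s t z * (ζ : ℂ))

theorem chiST_zero (hs : 0 < s) (t : ℝ) : chiST s t 0 = 0 := by
  rw [chiST_eq hs t (by simp), zero_mul]

theorem kernelFun_zero (hs : 0 < s) (t : ℝ) (ζ : Circle) : kernelFun s t ζ 0 = 1 := by
  simp [kernelFun, chiST_zero hs]

theorem half_kernelFun_sub_one {ζ : Circle} {z : ℂ} (h : 1 - chiST s t z * (ζ : ℂ) ≠ 0) :
    (kernelFun s t ζ z - 1) / 2 = chiST s t z * (ζ : ℂ) / (1 - chiST s t z * (ζ : ℂ)) := by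
  rw [kernelFun]
  field_simp
  ring

theorem re_kernelFun_nonneg (hs : 0 < s) (ht : 0 ≤ t) (ζ : Circle) {z : ℂ} (hz : ‖z‖ ≤ 1) :
    0 ≤ (kernelFun s t ζ z).re := by
  rw [kernelFun, re_cayley, norm_mul, Circle.norm_coe, mul_one]
  have := (norm_chiST_le hs ht hz).trans hz
  exact div_nonneg (sub_nonneg.2 (pow_le_one₀ (norm_nonneg _) this)) (sq_nonneg _)

theorem one_sub_chiST_mul_ne_zero (hs : 0 < s) (ht : 0 ≤ t) (ζ : Circle) {z : ℂ} (hz : ‖z‖ < 1) :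
    1 - chiST s t z * (ζ : ℂ) ≠ 0 :=
  one_sub_mul_circle_ne_zero ((norm_chiST_le hs ht hz.le).trans_lt hz) ζ

theorem exists_hasMomentGenFun (hs : 0 < s) (ht : 0 ≤ t) (ζ : Circle) :
    ∃ κ, HasMomentGenFun (chiST s t) ζ κ := by
  have hd : DifferentiableOn ℂ (kernelFun s t ζ) (Metric.ball 0 1) :=
    (((differentiableOn_chiST hs t).mul_const _).const_add 1).div
      (((differentiableOn_chiST hs t).mul_const _).const_sub 1)
      fun z hz => one_sub_chiST_mul_ne_zero hs ht ζ (mem_ball_zero_iff.1 hz)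
  obtain ⟨κ, hκ⟩ := exists_probabilityMeasure_momentGenFun hd
    (fun z hz => re_kernelFun_nonneg hs ht ζ (mem_ball_zero_iff.1 hz).le) (kernelFun_zero hs t ζ)
  exact ⟨κ, fun z hz => by
    rw [hκ z hz, half_kernelFun_sub_one (one_sub_chiST_mul_ne_zero hs ht ζ hz)]⟩

theorem HasMomentGenFun.unique {F : ℂ → ℂ} {ζ : Circle} {κ κ' : ProbabilityMeasure Circle}
    (h : HasMomentGenFun F ζ κ) (h' : HasMomentGenFun F ζ κ') : κ = κ' := by
  refine probabilityMeasure_ext_of_eventuallyEq ?_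
  filter_upwards [eventually_norm_lt one_pos] with z hz
  rw [h z hz, h' z hz]

/-! ### The density of the kernel -/

/-- The open disk misses supp ν_s; continuity extends the conclusion to the boundary. -/
theorem coe_chiST_mem_closure (hs : 0 < s) (t : ℝ) {z : ℂ} (hz : ‖z‖ ≤ 1) :
    ((chiST s t z : ℂ) : OnePoint ℂ) ∈ closure (chiSphere s t '' (suppNu s)ᶜ) := by
  have h1 : ∀ y : ℂ, ‖y‖ < 1 →
      ((chiST s t y : ℂ) : OnePoint ℂ) ∈ chiSphere s t '' (suppNu s)ᶜ := by
    intro y hy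
    refine ⟨(y : OnePoint ℂ), ?_, ?_⟩
    · rintro ⟨ω, -, hω⟩
      have : (ω : ℂ) = y := OnePoint.coe_injective hω
      rw [← this, Circle.norm_coe] at hy
      exact lt_irrefl _ hy
    · change (if ‖y‖ ≤ 1 then ((chiST s t y : ℂ) : OnePoint ℂ)
        else (((chiST s t y⁻¹)⁻¹ : ℂ) : OnePoint ℂ)) = _
      rw [if_pos hy.le]
  have hz' : z ∈ closure (Metric.ball (0 : ℂ) 1) := by
    rw [closure_ball _ one_ne_zero]
    exact mem_closedBall_zero_iff.2 hz
  have hc : ContinuousWithinAt (fun y => ((chiST s t y : ℂ) : OnePoint ℂ)) (Metric.ball 0 1) z :=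
    (OnePoint.continuous_coe.continuousAt.comp_continuousWithinAt
      (continuousOn_chiST hs t z (mem_closedBall_zero_iff.2 hz))).mono Metric.ball_subset_closedBall
  exact closure_mono (by rintro _ ⟨y, hy, rfl⟩; exact h1 y (mem_ball_zero_iff.1 hy))
    (hc.mem_closure_image hz')

theorem chiST_ne_of_mem_SigmaST (hs : 0 < s) {ζ : Circle}
    (hζ : ((ζ : ℂ) : OnePoint ℂ) ∈ SigmaST s t) {z : ℂ} (hz : ‖z‖ ≤ 1) : chiST s t z ≠ ζ :=
  fun h => hζ (h ▸ coe_chiST_mem_closure hs t hz)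

theorem one_sub_chiST_mul_ne_zero_of_mem_SigmaST (hs : 0 < s) {ζ : Circle}
    (hζ : ((ζ : ℂ) : OnePoint ℂ) ∈ SigmaST s t) {z : ℂ} (hz : ‖z‖ ≤ 1) :
    1 - chiST s t z * (ζ : ℂ) ≠ 0 := by
  intro h
  -- A zero would mean χ_{s,t}(z) = ζ⁻¹ = conj ζ, so by reflection χ_{s,t} would take the value ζ at
  -- conj z.
  refine chiST_ne_of_mem_SigmaST hs hζ (z := conj z) (by rwa [Complex.norm_conj]) ?_
  have h1 : chiST s t z = (ζ : ℂ)⁻¹ := eq_inv_of_mul_eq_one_left (sub_eq_zero.1 h).symm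
  rw [chiST_conj hs t hz, h1, ← Circle.coe_inv, Circle.coe_inv_eq_conj, Complex.conj_conj]

theorem diffContOnCl_kernelFun (hs : 0 < s) {ζ : Circle}
    (hζ : ((ζ : ℂ) : OnePoint ℂ) ∈ SigmaST s t) :
    DiffContOnCl ℂ (kernelFun s t ζ) (Metric.ball 0 1) := by
  have hne : ∀ z : ℂ, ‖z‖ ≤ 1 → 1 - chiST s t z * (ζ : ℂ) ≠ 0 := fun z hz =>
    one_sub_chiST_mul_ne_zero_of_mem_SigmaST hs hζ hz
  refine ⟨(((differentiableOn_chiST hs t).mul_const _).const_add 1).div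
      (((differentiableOn_chiST hs t).mul_const _).const_sub 1)
      fun z hz => hne z (mem_ball_zero_iff.1 hz).le, ?_⟩
  rw [closure_ball _ one_ne_zero]
  exact (continuousOn_const.add ((continuousOn_chiST hs t).mul continuousOn_const)).div
    (continuousOn_const.sub ((continuousOn_chiST hs t).mul continuousOn_const))
    fun z hz => hne z (mem_closedBall_zero_iff.1 hz)

theorem HasMomentGenFun.eq_boundaryMeasure (hs : 0 < s) (ht : 0 ≤ t) {ζ : Circle}
    (hζ : ((ζ : ℂ) : OnePoint ℂ) ∈ SigmaST s t) {κ : ProbabilityMeasure Circle}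
    (h : HasMomentGenFun (chiST s t) ζ κ) :
    (κ : Measure Circle) = boundaryMeasure (kernelFun s t ζ) := by
  have hd := diffContOnCl_kernelFun hs hζ
  have hne : ∀ z : ℂ, ‖z‖ ≤ 1 → 1 - chiST s t z * (ζ : ℂ) ≠ 0 := fun z hz =>
    one_sub_chiST_mul_ne_zero_of_mem_SigmaST hs hζ hz
  have hpos : ∀ ω : Circle, 0 ≤ (kernelFun s t ζ (ω : ℂ)⁻¹).re := fun ω =>
    have hω : ‖(ω : ℂ)⁻¹‖ ≤ 1 := by rw [norm_inv, Circle.norm_coe, inv_one]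
    re_kernelFun_nonneg hs ht ζ hω
  have h0 := kernelFun_zero hs t ζ
  have h' : HasMomentGenFun (chiST s t) ζ
      ⟨boundaryMeasure (kernelFun s t ζ), isProbabilityMeasure_boundaryMeasure hd hpos h0⟩ :=
    fun z hz => (boundaryMeasure_momentGenFun hd hpos h0 hz).trans
      (half_kernelFun_sub_one (hne z hz.le))
  exact congrArg Subtype.val (h.unique h')

theorem densST_eq (s t : ℝ) (ζ ω : Circle) : densST s t ζ ω =
    ‖1 - chi s ω‖ ^ 2 / ‖(ζ : ℂ) - chiST s t ω‖ ^ 2 *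
      ((1 - ‖chiST s t ω‖ ^ 2) / (1 - ‖chi s ω‖ ^ 2)) := by
  rw [densST, denomST_eq, Complex.ofReal_re]

theorem continuous_comp_circle {F : ℂ → ℂ} (hF : ContinuousOn F (Metric.closedBall 0 1)) :
    Continuous fun ω : Circle => F ω :=
  hF.comp_continuous continuous_circle_coe
    fun ω => mem_closedBall_zero_iff.2 (Circle.norm_coe ω).le

theorem measurable_densST (hs : 0 < s) (t : ℝ) (ζ : Circle) : Measurable (densST s t ζ) := by
  have h1 := (continuous_comp_circle (continuousOn_chi hs)).measurable
  have h2 := (continuous_comp_circle (continuousOn_chiST hs t)).measurable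
  simp_rw [funext (densST_eq s t ζ)]
  exact (((measurable_const.sub h1).norm.pow_const 2).div
    ((measurable_const.sub h2).norm.pow_const 2)).mul
    ((measurable_const.sub (h2.norm.pow_const 2)).div
      (measurable_const.sub (h1.norm.pow_const 2)))

theorem invPhi_circle_inv (hs : 0 < s) (ω : Circle) :
    (invPhi s (ω : ℂ)⁻¹).re = (invPhi s ω).re := by
  rw [← Circle.coe_inv, Circle.coe_inv_eq_conj, invPhi_conj hs (Circle.norm_coe ω).le,
    Complex.conj_re]

theorem re_invPhi_circle (hs : 0 < s) (ω : Circle) :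
    (invPhi s ω).re = (1 - ‖chi s ω‖ ^ 2) / ‖1 - chi s ω‖ ^ 2 := by
  have hω := (Circle.norm_coe ω).le
  rw [← cayley_chi hs hω, re_cayley]

theorem re_kernelFun_circle_inv (hs : 0 < s) {ζ : Circle}
    (hζ : ((ζ : ℂ) : OnePoint ℂ) ∈ SigmaST s t) (ω : Circle) :
    (kernelFun s t ζ (ω : ℂ)⁻¹).re
      = (1 - ‖chiST s t ω‖ ^ 2) / ‖(ζ : ℂ) - chiST s t ω‖ ^ 2 := by
  have hω := (Circle.norm_coe ω).le
  have hne := one_sub_chiST_mul_ne_zero_of_mem_SigmaST hs hζ (z := (ω : ℂ)⁻¹)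
    (by rw [norm_inv, Circle.norm_coe, inv_one])
  rw [kernelFun, re_cayley]
  have h1 : chiST s t (ω : ℂ)⁻¹ = conj (chiST s t ω) := by
    rw [← Circle.coe_inv, Circle.coe_inv_eq_conj, chiST_conj hs t hω]
  have h2 : ‖1 - conj (chiST s t ω) * (ζ : ℂ)‖ = ‖(ζ : ℂ) - chiST s t ω‖ := by
    have h3 : (ζ : ℂ) * conj (ζ : ℂ) = 1 := by
      rw [Complex.mul_conj, Circle.normSq_coe, Complex.ofReal_one]
    have h4 : 1 - conj (chiST s t ω) * (ζ : ℂ) = conj ((ζ : ℂ) - chiST s t ω) * (ζ : ℂ) := by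
      rw [map_sub]
      linear_combination -h3
    rw [h4, norm_mul, Circle.norm_coe, mul_one, Complex.norm_conj]
  rw [h1, h2, norm_mul, Circle.norm_coe, mul_one, Complex.norm_conj]

theorem re_kernelFun_eq_mul_densST (hs : 0 < s) {ζ : Circle}
    (hζ : ((ζ : ℂ) : OnePoint ℂ) ∈ SigmaST s t) (ω : Circle) :
    (kernelFun s t ζ (ω : ℂ)⁻¹).re = (invPhi s (ω : ℂ)⁻¹).re * densST s t ζ ω := by
  have hω := (Circle.norm_coe ω).le
  rw [re_kernelFun_circle_inv hs hζ, invPhi_circle_inv hs]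
  -- Where Re H = 0 the density is formally 0/0, but both sides vanish since |χ_{s,t}| = 1 there.
  rcases (re_invPhi_nonneg hs hω).eq_or_lt with h | h
  · rw [norm_chiST_circle_sq hs t, ← h]
    simp
  · have h1 : ‖1 - chi s ω‖ ≠ 0 := by
      rw [one_sub_chi hs hω]
      exact norm_ne_zero_iff.2 (div_ne_zero two_ne_zero (invPhi_add_one_ne_zero hs hω))
    have h2 := re_invPhi_circle hs ω
    have h3 : 1 - ‖chi s ω‖ ^ 2 ≠ 0 := fun h0 => by
      rw [h0, zero_div] at h2
      exact h.ne' h2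
    have h4 : ‖(ζ : ℂ) - chiST s t ω‖ ≠ 0 :=
      norm_ne_zero_iff.2 (sub_ne_zero.2 (chiST_ne_of_mem_SigmaST hs hζ hω).symm)
    rw [h2, densST_eq]
    field_simp

theorem kernel_eq_withDensity (hs : 0 < s) (ht : 0 ≤ t) {ζ : Circle}
    (hζ : ((ζ : ℂ) : OnePoint ℂ) ∈ SigmaST s t) {κ : ProbabilityMeasure Circle}
    (h : HasMomentGenFun (chiST s t) ζ κ) :
    (κ : Measure Circle) = (nu s : Measure Circle).withDensity
      fun ω => ENNReal.ofReal (densST s t ζ ω) := by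
  have hm : Measurable fun ω : Circle => ENNReal.ofReal (invPhi s (ω : ℂ)⁻¹).re :=
    (Complex.continuous_re.comp
      (continuous_comp_circle_inv (continuousOn_invPhi hs))).measurable.ennreal_ofReal
  have hν : (nu s : Measure Circle) = boundaryMeasure (invPhi s) := by rw [nu_eq hs]; rfl
  rw [h.eq_boundaryMeasure hs ht hζ, hν, boundaryMeasure, boundaryMeasure,
    ← withDensity_mul _ hm (measurable_densST hs t ζ).ennreal_ofReal]
  congr 1
  ext ω
  rw [re_kernelFun_eq_mul_densST hs hζ, Pi.mul_apply, ENNReal.ofReal_mul]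
  exact re_invPhi_nonneg hs (by rw [norm_inv, Circle.norm_coe, inv_one])

/-! ### Two-sided bounds for the density -/

theorem ae_nu_re_invPhi_pos (hs : 0 < s) :
    ∀ᵐ ω : Circle ∂(nu s : Measure Circle), 0 < (invPhi s ω).re := by
  have hm : Measurable fun ω : Circle => ENNReal.ofReal (invPhi s (ω : ℂ)⁻¹).re :=
    (Complex.continuous_re.comp
      (continuous_comp_circle_inv (continuousOn_invPhi hs))).measurable.ennreal_ofReal
  have hν : (nu s : Measure Circle) = boundaryMeasure (invPhi s) := by rw [nu_eq hs]; rfl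
  rw [hν, boundaryMeasure, ae_withDensity_iff hm]
  refine Eventually.of_forall fun ω hω => ?_
  rw [← invPhi_circle_inv hs]
  exact ENNReal.ofReal_pos.1 (pos_iff_ne_zero.2 hω)

theorem div_one_add_le_one_sub_exp_neg {y : ℝ} (hy : 0 ≤ y) : y / (1 + y) ≤ 1 - Real.exp (-y) := by
  have h1 := Real.add_one_le_exp y
  have h2 : Real.exp y * Real.exp (-y) = 1 := by rw [← Real.exp_add]; simp
  rw [div_le_iff₀ (by linarith)]
  nlinarith [Real.exp_pos (-y)]

theorem one_sub_exp_neg_le (y : ℝ) : 1 - Real.exp (-y) ≤ y := by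
  linarith [Real.add_one_le_exp (-y)]

theorem one_sub_exp_div_bounds (hs : 0 < s) (ht : 0 < t) {x M : ℝ} (hx : 0 < x) (hxM : x ≤ M) :
    t / (s * (1 + t * M)) ≤ (1 - Real.exp (-(t * x))) / (1 - Real.exp (-(s * x))) ∧
      (1 - Real.exp (-(t * x))) / (1 - Real.exp (-(s * x))) ≤ t * (1 + s * M) / s := by
  have hsx : 0 < s * x := mul_pos hs hx
  have htx : 0 < t * x := mul_pos ht hx
  have s1 := div_one_add_le_one_sub_exp_neg hsx.le
  have t1 := div_one_add_le_one_sub_exp_neg htx.le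
  have s2 := one_sub_exp_neg_le (s * x)
  have t2 := one_sub_exp_neg_le (t * x)
  have s0 : 0 < s * x / (1 + s * x) := by positivity
  have t0 : 0 < t * x / (1 + t * x) := by positivity
  have hM : 0 < M := hx.trans_le hxM
  constructor
  · calc t / (s * (1 + t * M)) ≤ t / (s * (1 + t * x)) := by gcongr
      _ = t * x / (1 + t * x) / (s * x) := by field_simp
      _ ≤ _ := div_le_div₀ (t0.le.trans t1) t1 (s0.trans_le s1) s2
  · calc _ ≤ t * x / (s * x / (1 + s * x)) := div_le_div₀ htx.le t2 s0 s1
      _ = t * (1 + s * x) / s := by field_simp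
      _ ≤ _ := by gcongr

theorem densST_bounds (hs : 0 < s) (ht : 0 < t) {ζ : Circle}
    (hζ : ((ζ : ℂ) : OnePoint ℂ) ∈ SigmaST s t) :
    ∃ c C : ℝ, 0 < c ∧ ∀ᵐ ω ∂(nu s : Measure Circle),
      c ≤ densST s t ζ ω ∧ densST s t ζ ω ≤ C := by
  have hcd : Continuous fun ω : Circle => ‖(ζ : ℂ) - chiST s t ω‖ :=
    (continuous_const.sub (continuous_comp_circle (continuousOn_chiST hs t))).norm
  have hcH : Continuous fun ω : Circle => ‖invPhi s ω + 1‖ :=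
    ((continuous_comp_circle (continuousOn_invPhi hs)).add continuous_const).norm
  obtain ⟨ω₀, -, h₀⟩ := isCompact_univ.exists_isMinOn univ_nonempty hcd.continuousOn
  obtain ⟨ω₁, -, h₁⟩ := isCompact_univ.exists_isMaxOn univ_nonempty hcH.continuousOn
  -- Compactness makes δ > 0 a lower bound for |ζ - χ_{s,t}|. The maximum M of |H + 1| serves twice:
  -- it bounds Re H, and |1 - χ_s| = 2/|H + 1| ≥ 2/M.
  set δ := ‖(ζ : ℂ) - chiST s t ω₀‖ with hδ
  set M := ‖invPhi s ω₁ + 1‖ with hM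
  have hδ0 : 0 < δ := norm_pos_iff.2
    (sub_ne_zero.2 (chiST_ne_of_mem_SigmaST hs hζ (Circle.norm_coe ω₀).le).symm)
  have hM0 : 0 < M := norm_pos_iff.2 (invPhi_add_one_ne_zero hs (Circle.norm_coe ω₁).le)
  refine ⟨(2 / M) ^ 2 / 2 ^ 2 * (t / (s * (1 + t * M))), 2 ^ 2 / δ ^ 2 * (t * (1 + s * M) / s),
    by positivity, ?_⟩
  -- Points with Re H = 0 must be discarded: there division by zero makes `densST` equal to 0, but
  -- they are ν_s-null.
  filter_upwards [ae_nu_re_invPhi_pos hs] with ω hpos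
  have hω := (Circle.norm_coe ω).le
  have a1 : δ ≤ ‖(ζ : ℂ) - chiST s t ω‖ := h₀ (mem_univ ω)
  have a2 : ‖invPhi s ω + 1‖ ≤ M := h₁ (mem_univ ω)
  have a3 : (invPhi s ω).re + 1 ≤ ‖invPhi s ω + 1‖ := by
    simpa using Complex.re_le_norm (invPhi s ω + 1)
  have a4 : ‖(ζ : ℂ) - chiST s t ω‖ ≤ 2 := by
    have h1 := norm_sub_le (ζ : ℂ) (chiST s t ω)
    have h2 := norm_chiST_le hs ht.le hω
    rw [Circle.norm_coe] at h1 h2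
    linarith
  have a5 : ‖1 - chi s ω‖ = 2 / ‖invPhi s ω + 1‖ := by
    rw [one_sub_chi hs hω, norm_div, Complex.norm_ofNat]
  have a6 : 2 / M ≤ ‖1 - chi s ω‖ := by
    rw [a5]
    exact div_le_div_of_nonneg_left zero_le_two (by linarith) a2
  have a7 : ‖1 - chi s ω‖ ≤ 2 := by
    rw [a5]
    exact div_le_self zero_le_two (by linarith)
  obtain ⟨b1, b2⟩ := one_sub_exp_div_bounds hs ht hpos (M := M) (by linarith)
  rw [densST_eq, norm_chiST_circle_sq hs t ω, ← chiST_self s ω, norm_chiST_circle_sq hs s ω,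
    chiST_self]
  have hb : 0 < t / (s * (1 + t * M)) := by positivity
  have hn : 0 < ‖(ζ : ℂ) - chiST s t ω‖ := hδ0.trans_le a1
  constructor
  · gcongr
  · have hb' := hb.le.trans b1
    gcongr

/-- Consequences of the presence of a density bounded above and away from `0`. -/
theorem withDensity_mutual_bounds {α : Type*} [MeasurableSpace α] {κ ν : Measure α}
    [IsFiniteMeasure κ] [IsFiniteMeasure ν] {d : α → ℝ} (hd : Measurable d)
    (hκ : κ = ν.withDensity fun ω => ENNReal.ofReal (d ω)) {c C : ℝ} (hc : 0 < c)
    (hb : ∀ᵐ ω ∂ν, c ≤ d ω ∧ d ω ≤ C) :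
    κ ≪ ν ∧ ν ≪ κ ∧ ∃ D : ℝ≥0,
      (∀ᵐ ω ∂ν, κ.rnDeriv ν ω ≤ D) ∧ (∀ᵐ ω ∂κ, ν.rnDeriv κ ω ≤ D) := by
  have h1 : κ ≪ ν := hκ ▸ withDensity_absolutelyContinuous ν _
  have h2 : ν ≪ κ := by
    rw [hκ]
    refine withDensity_absolutelyContinuous' hd.ennreal_ofReal.aemeasurable ?_
    filter_upwards [hb] with ω hω
    exact (ENNReal.ofReal_pos.2 (hc.trans_le hω.1)).ne'
  have h3 : κ.rnDeriv ν =ᵐ[ν] fun ω => ENNReal.ofReal (d ω) := by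
    rw [hκ]
    exact Measure.rnDeriv_withDensity ν hd.ennreal_ofReal
  refine ⟨h1, h2, max C.toNNReal c⁻¹.toNNReal, ?_, ?_⟩
  · filter_upwards [h3, hb] with ω hω hdω
    rw [hω]
    exact (ENNReal.ofReal_le_ofReal hdω.2).trans (ENNReal.coe_le_coe.2 (le_max_left _ _))
  · filter_upwards [h1.ae_le h3, h1.ae_le hb, Measure.inv_rnDeriv h1] with ω hω hdω hi
    rw [← hi, Pi.inv_apply, hω, ← ENNReal.ofReal_inv_of_pos (hc.trans_le hdω.1)]
    refine (ENNReal.ofReal_le_ofReal ?_).trans (ENNReal.coe_le_coe.2 (le_max_right _ _))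
    exact inv_anti₀ hc hdω.1

end

end FreeUnitary

theorem mainTheorem7 (s t : ℝ) (hs : 0 < s) (ht : 0 < t) :
    -- the background objects are well defined: the law `ν_s` exists and is unique, and `χ_s`
    -- extends continuously to the closed disk
    (∀ μ : ProbabilityMeasure Circle,
      FreeUnitary.HasSigmaTransform μ (FreeUnitary.sigmaT s) ↔ μ = FreeUnitary.nu s) ∧
    ContinuousOn (FreeUnitary.chi s) (Metric.closedBall 0 1) ∧
    ∀ ζ : Circle, ∃ κ : ProbabilityMeasure Circle,
      -- `κ = k_{s,t}(ζ, ·)` exists and is unique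
      (∀ κ' : ProbabilityMeasure Circle,
        FreeUnitary.HasMomentGenFun (FreeUnitary.chiST s t) ζ κ' ↔ κ' = κ) ∧
      -- for `s = t` it is the one-parameter kernel `k_s(ζ, ·)`
      (s = t → ∀ κ' : ProbabilityMeasure Circle,
        FreeUnitary.HasMomentGenFun (FreeUnitary.chi s) ζ κ' ↔ κ' = κ) ∧
      (t / 2 ≤ s → ((ζ : ℂ) : OnePoint ℂ) ∈ FreeUnitary.SigmaST s t →
        -- absolute continuity, with the explicit density
        Measurable (FreeUnitary.densST s t ζ) ∧
        (κ : Measure Circle) ≪ (FreeUnitary.nu s : Measure Circle) ∧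
        (κ : Measure Circle) = (FreeUnitary.nu s : Measure Circle).withDensity
          (fun ω => ENNReal.ofReal (FreeUnitary.densST s t ζ ω)) ∧
        -- mutual absolute continuity, with bounded densities in both directions
        (FreeUnitary.nu s : Measure Circle) ≪ (κ : Measure Circle) ∧
        (∃ c C : ℝ, 0 < c ∧ ∀ᵐ ω ∂(FreeUnitary.nu s : Measure Circle),
          c ≤ FreeUnitary.densST s t ζ ω ∧ FreeUnitary.densST s t ζ ω ≤ C) ∧
        (∃ C : ℝ≥0,
          (∀ᵐ ω ∂(FreeUnitary.nu s : Measure Circle),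
            (κ : Measure Circle).rnDeriv (FreeUnitary.nu s : Measure Circle) ω ≤ C) ∧
          (∀ᵐ ω ∂(κ : Measure Circle),
            (FreeUnitary.nu s : Measure Circle).rnDeriv (κ : Measure Circle) ω ≤ C)) ∧
        (κ : Measure Circle).support = (FreeUnitary.nu s : Measure Circle).support) := by
  refine ⟨FreeUnitary.hasSigmaTransform_iff hs, FreeUnitary.continuousOn_chi hs, fun ζ => ?_⟩
  obtain ⟨κ, hκ⟩ := FreeUnitary.exists_hasMomentGenFun hs ht.le ζ
  have hiff : ∀ κ' : ProbabilityMeasure Circle,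
      FreeUnitary.HasMomentGenFun (FreeUnitary.chiST s t) ζ κ' ↔ κ' = κ :=
    fun κ' => ⟨fun h => h.unique hκ, fun h => h ▸ hκ⟩
  refine ⟨κ, hiff, ?_, fun _ hζ => ?_⟩
  · rintro rfl
    rwa [funext (FreeUnitary.chiST_self s)] at hiff
  · have hm := FreeUnitary.measurable_densST hs t ζ
    have hd := FreeUnitary.kernel_eq_withDensity hs ht.le hζ hκ
    obtain ⟨c, C, hc, hb⟩ := FreeUnitary.densST_bounds hs ht hζ
    obtain ⟨h1, h2, h3⟩ := FreeUnitary.withDensity_mutual_bounds hm hd hc hb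
    exact ⟨hm, h1, hd, h2, ⟨c, C, hc, hb⟩, h3, h1.support_mono.antisymm h2.support_mono⟩
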